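/- Let $\mathbb{K}$ be a field of characteristic $0$. For a finite simple graph $H$ with edge set $E(H)$, fix for each edge $e=\{i,j\}$ the linear form $\ell_e = x_i-x_j$ with $i<j$ (for a fixed linear order of the vertices), let $S_H=\mathbb{K}[y_e : e\in E(H)]$, and let $I_H\subseteq S_H$ be the ideal generated by the squares $y_e^2$ of all variables and by all polynomials $$f_{\Lambda,c} = \sum_{t\in\Lambda} c_t \prod_{s\in\Lambda\setminus\{t\}} y_s ,\qquad \Lambda\subseteq E(H),\quad c\in\mathbb{K}^{\Lambda},\quad \sum_{t\in\Lambda} c_t\ell_t=0 .$$ The Artinian Orlik–Terao (AOT) algebra of $H$ is $S_H/I_H$. A standard graded Artinian algebra $A=S/J$, where $S$ is a polynomial ring over $\mathbb{K}$ and $J$ is a homogeneous ideal, has the weak Lefschetz property (WLP) if there is a linear form $\ell\in S_1$ such that for every $i\ge 0$ the multiplication map $\cdot\ell\colon A_i\to A_{i+1}$ has maximal rank, i.e. is injective or surjective. Theorem. Let $G$ be a simple graph on $5$ vertices containing a cycle $Z$ of length $5$, and suppose that for some monomial order $\prec$ on $S_G$ the algebra $S_G/\mathrm{in}_\prec(I_G)$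 has the WLP. Let $u\neq w$ be two vertices of $Z$ that are not adjacent in $G$, and let $G'$ be the graph obtained from $G$ by adding the edge $\{u,w\}$ (a chord of $Z$ not already present in $G$). Then the AOT algebra $S_{G'}/I_{G'}$ of $G'$ has the WLP. -/

import Mathlib

open MvPolynomial

noncomputable section

/-- The Orlik-Terao ideal of a family `ℓ` of linear forms (the arrangement with hyperplanes
`V(ℓ i)`): the ideal of `K[y_i : i ∈ ι]` generated by the polynomials
`f_Λ = ∑_{t ∈ Λ} c_t ∏_{s ∈ Λ, s ≠ t} y_s`, one for each linear relation
`∑_{t ∈ Λ} c_t ℓ_t = 0` over a finite set `Λ` of indices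
(for an independent `Λ` all `c_t` vanish, and so does the generator). -/
def orlikTeraoIdeal (K : Type*) [Field K] {ι M : Type*} [DecidableEq ι]
    [AddCommGroup M] [Module K M] (ℓ : ι → M) : Ideal (MvPolynomial ι K) :=
  Ideal.span {f | ∃ (Λ : Finset ι) (c : ι → K), ∑ t ∈ Λ, c t • ℓ t = 0 ∧
    f = ∑ t ∈ Λ, C (c t) * ∏ s ∈ Λ.erase t, X s}

/-- The defining ideal of the Artinian Orlik-Terao algebra of the family `ℓ`:
the Orlik-Terao ideal together with the squares of the variables. -/
def aotIdeal (K : Type*) [Field K] {ι M : Type*} [DecidableEq ι]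
    [AddCommGroup M] [Module K M] (ℓ : ι → M) : Ideal (MvPolynomial ι K) :=
  orlikTeraoIdeal K ℓ ⊔ Ideal.span (Set.range fun i : ι => (X i : MvPolynomial ι K) ^ 2)

/-- The linear form `x_i - x_j` on `K^V` attached to an edge `{i, j}`, `i < j`, of a graph. -/
def graphicForm (K : Type*) [Field K] {V : Type*} [LinearOrder V] (G : SimpleGraph V)
    (e : G.edgeSet) : Module.Dual K (V → K) :=
  (LinearMap.proj (Sym2.inf (e : Sym2 V)) : (V → K) →ₗ[K] K) -
    LinearMap.proj (Sym2.sup (e : Sym2 V))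

/-- The ideal `I` in `K[y_e : e an edge of G]` for which `K[y_e] / I` is the Artinian Orlik-Terao
algebra of the graphic arrangement of `G`. -/
def graphicAOTIdeal (K : Type*) [Field K] {V : Type*} [LinearOrder V] (G : SimpleGraph V) :
    Ideal (MvPolynomial G.edgeSet K) :=
  aotIdeal K (graphicForm K G)

/-- The initial ideal of `J` with respect to a monomial order `m`. -/
def initialIdeal {σ K : Type*} [Field K] (m : MonomialOrder σ) (J : Ideal (MvPolynomial σ K)) :
    Ideal (MvPolynomial σ K) :=
  Ideal.span (m.leadingTerm '' (J : Set (MvPolynomial σ K)))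

/-- The degree `i` part `A_i` of `A = K[x_s : s ∈ σ] / J`: the classes of the homogeneous
polynomials of degree `i`. -/
def gradedPiece {σ K : Type*} [Field K] (J : Ideal (MvPolynomial σ K)) (i : ℕ) :
    Submodule K (MvPolynomial σ K ⧸ J) :=
  (homogeneousSubmodule σ K i).map (Ideal.Quotient.mkₐ K J).toLinearMap

theorem mul_mem_gradedPiece {σ K : Type*} [Field K] (J : Ideal (MvPolynomial σ K))
    {l : MvPolynomial σ K} (hl : l.IsHomogeneous 1) (i : ℕ)
    (a : MvPolynomial σ K ⧸ J) (ha : a ∈ gradedPiece J i) :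
    LinearMap.mulLeft K (Ideal.Quotient.mk J l) a ∈ gradedPiece J (i + 1) := by
  obtain ⟨f, hf, rfl⟩ := ha
  refine ⟨l * f, ?_, ?_⟩
  · have hf' : f.IsHomogeneous i := hf
    have h := hl.mul hf'
    rw [Nat.add_comm] at h
    exact h
  · simp

/-- Multiplication `μ_l : A_i → A_{i+1}` by a linear form `l`, where `A = K[x_s : s ∈ σ] / J`. -/
def mulLinearForm {σ K : Type*} [Field K] (J : Ideal (MvPolynomial σ K))
    {l : MvPolynomial σ K} (hl : l.IsHomogeneous 1) (i : ℕ) :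
    gradedPiece J i →ₗ[K] gradedPiece J (i + 1) :=
  (LinearMap.mulLeft K (Ideal.Quotient.mk J l)).restrict (mul_mem_gradedPiece J hl i)

/-- The weak Lefschetz property of the standard graded algebra `K[x_s : s ∈ σ] / J` (for a
homogeneous ideal `J` with Artinian quotient): some linear form `l` is such that
all maps `μ_l : A_i → A_{i+1}` have maximal rank, that is, are injective or surjective. -/
def HasWLP {σ K : Type*} [Field K] (J : Ideal (MvPolynomial σ K)) : Prop :=
  ∃ (l : MvPolynomial σ K) (hl : l.IsHomogeneous 1), ∀ i : ℕ,
    Function.Injective (mulLinearForm J hl i) ∨ Function.Surjective (mulLinearForm J hl i)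

end

/-! Adding an edge keeps a 5-cycle Hamiltonian, so it is enough to treat all graphs on five vertices
that contain one. Orient the cycle, with edge forms `z i` summing to zero; every further edge is a
chord, whose form is up to sign `z i + z (i + 1)`. The Lefschetz element lives on the cycle alone: L
= ∑ a_i y_i with all a_i nonzero and cyclically consecutive a_i distinct, and chords get coefficient
0. Hence L is compatible with deleting and with contracting a chord e.

The model is the sequence 0 → A(G - e) → A(G) → A(G/e)(-1) → 0: injectivity of L in degree d, or
vanishing of A/LA in degree d, follows from the same for the deletion in degree d and for the
contraction in degree d - 1. With C the set of contracted chords, the inductive claim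
(`maximal_rank_of_chords`) is that L is injective in degrees at most 2 - |C| and that A/LA vanishes
in degree 4 - |C|. For C = ∅, L is injective in degrees 0, 1, 2 and surjective onto degree 4, hence
onto every higher degree; this is the WLP (`hasWLP_aotIdeal`).

For injectivity, exactness is replaced by functionals. To a subspace W and a point x belongs a
functional sending the monomial of a basis S of W to ∏_{s ∉ S} ℓ_s(x). These kill the ideal
(`killedByFlats_of_mem_aotIdeal`) and pass to deletion and contraction. The induction carries
`FlatInjective`, which assumes only that L f is killed by them; it is never needed that they cut out
the ideal.

The base cases (`contractedCycle_maximal_rank`) have no chords left: a 5-cycle, a digon with a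
triangle, a triangle with one edge tripled, or a configuration with a loop, whose algebra is zero.
Each is an explicit computation. -/

noncomputable section

/-! ### Squarefree monomials and subsets of the index set. -/

section SquarefreeMonomials

/-- The exponent vector of the squarefree monomial with support `S`. -/
def squarefreeExp {ι : Type*} (S : Finset ι) : ι →₀ ℕ := ∑ s ∈ S, Finsupp.single s 1

theorem squarefreeExp_apply {ι : Type*} [DecidableEq ι] (S : Finset ι) (i : ι) :
    squarefreeExp S i = if i ∈ S then 1 else 0 := by
  simp [squarefreeExp, Finsupp.finsetSum_apply, Finsupp.single_apply]

theorem squarefreeExp_injective {ι : Type*} :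
    Function.Injective (squarefreeExp : Finset ι → ι →₀ ℕ) := by
  classical
  intro S T h
  ext i
  have := DFunLike.congr_fun h i
  simp only [squarefreeExp_apply] at this
  split_ifs at this <;> simp_all

theorem degree_squarefreeExp {ι : Type*} (S : Finset ι) : (squarefreeExp S).degree = S.card := by
  simp [squarefreeExp]

theorem exists_eq_squarefreeExp {ι : Type*} (d : ι →₀ ℕ) (h : ∀ i, d i < 2) :
    ∃ S, d = squarefreeExp S := by
  classical
  refine ⟨d.support, ?_⟩
  ext i
  have := h i
  rw [squarefreeExp_apply]
  simp only [Finsupp.mem_support_iff]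
  split_ifs <;> omega

theorem prod_X_eq_monomial {ι K : Type*} [Field K] (S : Finset ι) :
    ∏ s ∈ S, (X s : MvPolynomial ι K) = monomial (squarefreeExp S) 1 := by
  rw [squarefreeExp, monomial_sum_one]
  rfl

theorem squarefreeExp_add {ι : Type*} [DecidableEq ι] {S T : Finset ι} (h : Disjoint S T) :
    squarefreeExp S + squarefreeExp T = squarefreeExp (S ∪ T) := by
  rw [squarefreeExp, squarefreeExp, squarefreeExp, Finset.sum_union h]

theorem squarefreeExp_map {ι κ : Type*} (j : ι ↪ κ) (S : Finset ι) :
    squarefreeExp (S.map j) = (squarefreeExp S).mapDomain j := by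
  simp [squarefreeExp, Finsupp.mapDomain_finsetSum, Finsupp.mapDomain_single]

theorem optionElim_squarefreeExp {κ : Type*} (S : Finset κ) :
    (squarefreeExp S).optionElim 1 = squarefreeExp (Finset.insertNone S) := by
  classical
  ext (_ | s) <;> simp [squarefreeExp_apply]

theorem sum_finset_option {κ A : Type*} [Fintype κ] [DecidableEq κ] [AddCommMonoid A]
    (g : Finset (Option κ) → A) :
    ∑ S, g S = ∑ S : Finset κ, g (S.map .some) + ∑ S : Finset κ, g (Finset.insertNone S) := by
  rw [← Finset.sum_add_distrib]
  let e : Finset κ × Bool ≃ Finset (Option κ) :=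
    { toFun := fun p => if p.2 then Finset.insertNone p.1 else p.1.map .some
      invFun := fun S => (Finset.eraseNone S, decide (none ∈ S))
      left_inv := by rintro ⟨S, _ | _⟩ <;> simp
      right_inv := by
        intro S
        by_cases h : none ∈ S
        · simp [h]
        · simp [h] }
  rw [← e.sum_comp, Fintype.sum_prod_type]
  refine Finset.sum_congr rfl fun S _ => ?_
  simp [e, add_comm]

end SquarefreeMonomials

/-! ### Functionals attached to flats, and why they kill the ideal. -/

section FlatFunctional

variable {K : Type*} [Field K] {ι M : Type*} [AddCommGroup M] [Module K M]

/-- `S` indexes a basis of `W`. -/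
def IsBasisOf (ℓ : ι → M) (W : Submodule K M) (S : Finset ι) : Prop :=
  Submodule.span K (ℓ '' S) = W ∧ S.card = Module.finrank K W

open Classical in
/-- The functional on the Orlik-Terao algebra attached to a flat `W` and a point `x`: it sends the
squarefree monomial of a basis `S` of `W` to `∏ ℓ_s(x)`, the product over `s ∉ S`, and all other
monomials to `0`. -/
def flatFunctional [Fintype ι] [DecidableEq ι] (ℓ : ι → M) (W : Submodule K M) (x : Module.Dual K M) :
    MvPolynomial ι K →ₗ[K] K :=
  ∑ S : Finset ι, (if IsBasisOf ℓ W S then ∏ s ∈ Sᶜ, x (ℓ s) else 0) • lcoeff K (squarefreeExp S)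

open Classical in
theorem flatFunctional_apply [Fintype ι] [DecidableEq ι] (ℓ : ι → M) (W : Submodule K M) (x : Module.Dual K M)
    (f : MvPolynomial ι K) : flatFunctional ℓ W x f =
      ∑ S : Finset ι, (if IsBasisOf ℓ W S then ∏ s ∈ Sᶜ, x (ℓ s) else 0) *
        coeff (squarefreeExp S) f := by
  simp only [flatFunctional, LinearMap.sum_apply, LinearMap.smul_apply, smul_eq_mul]
  rfl

theorem flatFunctional_monomial_of_two_le [Fintype ι] [DecidableEq ι] (ℓ : ι → M) (W : Submodule K M)
    (x : Module.Dual K M) {d : ι →₀ ℕ} {i : ι} (h : 2 ≤ d i) (c : K) :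
    flatFunctional ℓ W x (monomial d c) = 0 := by
  classical
  rw [flatFunctional_apply]
  refine Finset.sum_eq_zero fun S _ => ?_
  rw [coeff_monomial, if_neg (c := d = _), mul_zero]
  rintro rfl
  rw [squarefreeExp_apply] at h
  split_ifs at h <;> omega

open Classical in
theorem flatFunctional_monomial [Fintype ι] [DecidableEq ι] (ℓ : ι → M) (W : Submodule K M)
    (x : Module.Dual K M) (S : Finset ι) (c : K) :
    flatFunctional ℓ W x (monomial (squarefreeExp S) c) =
      (if IsBasisOf ℓ W S then ∏ s ∈ Sᶜ, x (ℓ s) else 0) * c := by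
  rw [flatFunctional_apply, Finset.sum_eq_single S]
  · rw [coeff_monomial, if_pos rfl]
  · intro T _ hT
    rw [coeff_monomial, if_neg (fun h => hT (squarefreeExp_injective h).symm), mul_zero]
  · simp

/-- The polynomials killed by all functionals attached to flats. -/
def KilledByFlats [Fintype ι] [DecidableEq ι] (ℓ : ι → M) (f : MvPolynomial ι K) : Prop :=
  ∀ W x, flatFunctional ℓ W x f = 0

theorem KilledByFlats.add [Fintype ι] [DecidableEq ι] {ℓ : ι → M} {f g : MvPolynomial ι K}
    (hf : KilledByFlats ℓ f) (hg : KilledByFlats ℓ g) : KilledByFlats ℓ (f + g) := fun W x => by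
  rw [map_add, hf W x, hg W x, add_zero]

theorem mem_span_of_relation [DecidableEq ι] {ℓ : ι → M} {Λ : Finset ι} {c : ι → K}
    (h : ∑ t ∈ Λ, c t • ℓ t = 0) {t : ι} (ht : t ∈ Λ) (hc : c t ≠ 0) :
    ℓ t ∈ Submodule.span K (ℓ '' (Λ.erase t : Finset ι)) := by
  rw [← Finset.add_sum_erase _ _ ht] at h
  have h' : ℓ t = -(c t)⁻¹ • ∑ s ∈ Λ.erase t, c s • ℓ s := by
    rw [eq_neg_of_add_eq_zero_right h]
    simp [smul_smul, hc]
  rw [h']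
  refine Submodule.smul_mem _ _ (Submodule.sum_mem _ fun s hs => Submodule.smul_mem _ _ ?_)
  exact Submodule.subset_span ⟨s, hs, rfl⟩

theorem span_image_erase [DecidableEq ι] {ℓ : ι → M} {S : Finset ι} {t : ι}
    (h : ℓ t ∈ Submodule.span K (ℓ '' (S.erase t : Finset ι))) :
    Submodule.span K (ℓ '' (S.erase t : Finset ι)) = Submodule.span K (ℓ '' S) := by
  refine le_antisymm (Submodule.span_mono (Set.image_mono (by simp))) ?_
  rw [Submodule.span_le]
  rintro _ ⟨s, hs, rfl⟩
  by_cases hst : s = t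
  · exact hst ▸ h
  · exact Submodule.subset_span ⟨s, by simpa [hst] using hs, rfl⟩

theorem finrank_span_image_le (ℓ : ι → M) (S : Finset ι) :
    Module.finrank K (Submodule.span K (ℓ '' S)) ≤ S.card := by
  classical
  have h := finrank_span_finset_le_card (R := K) (S.image ℓ)
  rw [Finset.coe_image] at h
  exact h.trans Finset.card_image_le

theorem not_isBasisOf [DecidableEq ι] {ℓ : ι → M} {W : Submodule K M} {S : Finset ι} {t : ι}
    (ht : t ∈ S) (h : ℓ t ∈ Submodule.span K (ℓ '' (S.erase t : Finset ι))) :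
    ¬ IsBasisOf ℓ W S := by
  rintro ⟨rfl, hc⟩
  rw [← span_image_erase h] at hc
  have := finrank_span_image_le (K := K) ℓ (S.erase t)
  have := Finset.card_erase_lt_of_mem ht
  omega

/-- Only a squarefree multiplier, with support `U`, matters. If `U` is disjoint from `Λ`, removing
any `t` with `c t ≠ 0` leaves the span of `U ∪ Λ` unchanged and puts the factor `x (ℓ t)` into the
complementary product; the total is a common factor times `x` of the relation. If `U` meets `Λ`, a
squarefree term with nonzero coefficient contains all of `Λ`, so its support is dependent and is no
basis. -/
theorem flatFunctional_monomial_mul_relation [Fintype ι] [DecidableEq ι] (ℓ : ι → M)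
    (W : Submodule K M) (x : Module.Dual K M) {Λ : Finset ι} {c : ι → K}
    (h : ∑ t ∈ Λ, c t • ℓ t = 0) (u : ι →₀ ℕ) :
    flatFunctional ℓ W x
      (monomial u 1 * ∑ t ∈ Λ, C (c t) * ∏ s ∈ Λ.erase t, X s) = 0 := by
  classical
  have hexp : monomial u 1 * ∑ t ∈ Λ, C (c t) * ∏ s ∈ Λ.erase t, (X s : MvPolynomial ι K) =
      ∑ t ∈ Λ, monomial (u + squarefreeExp (Λ.erase t)) (c t) := by
    rw [Finset.mul_sum]
    refine Finset.sum_congr rfl fun t _ => ?_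
    rw [prod_X_eq_monomial, C_mul_monomial, monomial_mul]
    simp
  rw [hexp, map_sum]
  by_cases hu : ∃ i, 2 ≤ u i
  · obtain ⟨i, hi⟩ := hu
    refine Finset.sum_eq_zero fun t _ => flatFunctional_monomial_of_two_le ℓ W x (i := i) ?_ _
    simp only [Finsupp.add_apply]
    omega
  push Not at hu
  obtain ⟨U, rfl⟩ := exists_eq_squarefreeExp u hu
  by_cases hdis : Disjoint U Λ
  · have key : ∀ t ∈ Λ,
        flatFunctional ℓ W x (monomial (squarefreeExp U + squarefreeExp (Λ.erase t)) (c t)) =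
        (if Submodule.span K (ℓ '' (U ∪ Λ : Finset ι)) = W ∧
            (U ∪ Λ).card = Module.finrank K W + 1 then ∏ s ∈ (U ∪ Λ)ᶜ, x (ℓ s) else 0) *
          (c t * x (ℓ t)) := by
      intro t ht
      rw [squarefreeExp_add (hdis.mono_right (Finset.erase_subset _ _)), flatFunctional_monomial]
      by_cases hc : c t = 0
      · simp [hc]
      have htU : t ∉ U := fun h' => Finset.disjoint_left.mp hdis h' ht
      have hE : U ∪ Λ.erase t = (U ∪ Λ).erase t := by
        rw [Finset.erase_union_distrib, Finset.erase_eq_of_notMem htU]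
      have hmem : t ∈ U ∪ Λ := Finset.mem_union_right _ ht
      -- The span and the cardinality condition become independent of `t`, which lets the common
      -- factor be pulled out of the sum.
      have hspan := span_image_erase (K := K) (ℓ := ℓ)
        (Submodule.span_mono (Set.image_mono (by
          rw [← hE]; exact_mod_cast Finset.subset_union_right)) (mem_span_of_relation h ht hc))
      have hcard := Finset.card_erase_add_one hmem
      have hcompl : ((U ∪ Λ).erase t)ᶜ = insert t (U ∪ Λ)ᶜ := Finset.compl_erase
      rw [hE, IsBasisOf, hspan, hcompl, Finset.prod_insert (by simp [ht]), ← hcard]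
      simp only [Nat.add_right_cancel_iff]
      split_ifs <;> ring
    rw [Finset.sum_congr rfl key, ← Finset.mul_sum]
    have : ∑ t ∈ Λ, c t * x (ℓ t) = x (∑ t ∈ Λ, c t • ℓ t) := by simp
    rw [this, h, map_zero, mul_zero]
  · obtain ⟨v, hvU, hvΛ⟩ := Finset.not_disjoint_iff.mp hdis
    refine Finset.sum_eq_zero fun t ht => ?_
    by_cases htd : Disjoint U (Λ.erase t)
    · rw [squarefreeExp_add htd, flatFunctional_monomial]
      by_cases hc : c t = 0
      · simp [hc]
      have hvt : v = t := by
        by_contra hne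
        exact Finset.disjoint_left.mp htd hvU (Finset.mem_erase.mpr ⟨hne, hvΛ⟩)
      subst hvt
      rw [if_neg, zero_mul]
      refine not_isBasisOf (Finset.mem_union_left _ hvU)
        (Submodule.span_mono (Set.image_mono ?_) (mem_span_of_relation h ht hc))
      intro s hs
      simp at hs ⊢
      tauto
    · obtain ⟨i, hi1, hi2⟩ := Finset.not_disjoint_iff.mp htd
      refine flatFunctional_monomial_of_two_le ℓ W x (i := i) ?_ _
      simp [squarefreeExp_apply, hi1, Finset.mem_erase.mp hi2]

theorem killedByFlats_of_mem_aotIdeal [Fintype ι] [DecidableEq ι] {ℓ : ι → M}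
    {f : MvPolynomial ι K} (hf : f ∈ aotIdeal K ℓ) : KilledByFlats ℓ f := by
  intro W x
  suffices h : ∀ p : MvPolynomial ι K, flatFunctional ℓ W x (p * f) = 0 by simpa using h 1
  rw [aotIdeal, orlikTeraoIdeal, ← Ideal.span_union] at hf
  induction hf using Submodule.span_induction with
  | zero => simp
  | add f g _ _ hf hg => intro p; rw [mul_add, map_add, hf, hg, add_zero]
  | smul q f _ hf => intro p; rw [smul_eq_mul, ← mul_assoc]; exact hf _
  | mem f hf =>
    intro p
    induction p using MvPolynomial.induction_on' with
    | add p q hp hq => rw [add_mul, map_add, hp, hq, add_zero]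
    | monomial u a =>
      have hmon : (monomial u a : MvPolynomial ι K) = a • monomial u 1 := by simp [smul_monomial]
      rw [hmon, smul_mul_assoc, map_smul]
      rcases hf with ⟨Λ, c, h, rfl⟩ | ⟨i, rfl⟩
      · rw [flatFunctional_monomial_mul_relation ℓ W x h, smul_zero]
      · simp only [X_pow_eq_monomial, monomial_mul]
        rw [flatFunctional_monomial_of_two_le ℓ W x (i := i) (by simp), smul_zero]

end FlatFunctional

/-! ### Flat functionals under deletion and contraction of the index `none`. -/

section DeletionContraction

variable {K : Type*} [Field K] {ι κ M : Type*} [AddCommGroup M] [Module K M]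

/-- No monomial that occurs involves `none`, so `none` always lies in the complement and contributes
one common factor. -/
theorem flatFunctional_rename_some [Fintype κ] [DecidableEq κ] (ℓ : Option κ → M)
    (W : Submodule K M) (x : Module.Dual K M) (g : MvPolynomial κ K) :
    flatFunctional ℓ W x (rename some g) =
      x (ℓ none) * flatFunctional (fun s => ℓ (some s)) W x g := by
  classical
  rw [flatFunctional_apply, sum_finset_option, flatFunctional_apply, Finset.mul_sum]
  have h2 : ∀ S : Finset κ, coeff (squarefreeExp (Finset.insertNone S)) (rename some g) = 0 := by
    intro S
    refine coeff_rename_eq_zero _ _ _ fun u hu => ?_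
    have := DFunLike.congr_fun hu none
    rw [Finsupp.mapDomain_of_notMem_range _ _ (by simp), squarefreeExp_apply] at this
    simp at this
  simp only [h2, mul_zero, Finset.sum_const_zero, add_zero]
  refine Finset.sum_congr rfl fun S _ => ?_
  have hc : (S.map Function.Embedding.some)ᶜ = Finset.insertNone Sᶜ := by
    ext (_ | s) <;> simp
  have hb : IsBasisOf ℓ W (S.map Function.Embedding.some) ↔
      IsBasisOf (fun s => ℓ (some s)) W S := by
    simp [IsBasisOf, Set.image_image]
  have h1 : coeff (squarefreeExp (S.map Function.Embedding.some)) (rename some g) =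
      coeff (squarefreeExp S) g := by
    rw [squarefreeExp_map]
    exact coeff_rename_mapDomain _ (Option.some_injective _) _ _
  rw [h1, hc, Finset.prod_insertNone]
  simp only [hb]
  split_ifs <;> ring

/-- The factor `x (ℓ none)` may vanish at the given `x`. Moving along the line `x + t • x₀` with `x₀
(ℓ none) ≠ 0` makes both factors polynomials in `t`; their product vanishes at every point of an
infinite field, the first factor is a nonzero polynomial, so the second is zero, in particular at `t
= 0`. -/
theorem KilledByFlats.of_rename_some [Infinite K] [Fintype κ] [DecidableEq κ] {ℓ : Option κ → M}
    (h0 : ℓ none ≠ 0) {g : MvPolynomial κ K} (h : KilledByFlats ℓ (rename some g)) :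
    KilledByFlats (fun s => ℓ (some s)) g := by
  classical
  intro W x
  obtain ⟨x₀, hx₀⟩ : ∃ x₀ : Module.Dual K M, x₀ (ℓ none) ≠ 0 := by
    by_contra! hcon
    exact h0 ((Module.forall_dual_apply_eq_zero_iff K _).mp hcon)
  let P : Polynomial K := ∑ S : Finset κ,
    (if IsBasisOf (fun s => ℓ (some s)) W S then
      ∏ s ∈ Sᶜ, (Polynomial.C (x (ℓ (some s))) + Polynomial.X * Polynomial.C (x₀ (ℓ (some s))))
      else 0) * Polynomial.C (coeff (squarefreeExp S) g)
  have hP : ∀ t, P.eval t = flatFunctional (fun s => ℓ (some s)) W (x + t • x₀) g := by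
    intro t
    rw [flatFunctional_apply, Polynomial.eval_finsetSum]
    refine Finset.sum_congr rfl fun S _ => ?_
    split_ifs <;> simp [Polynomial.eval_prod, mul_comm t]
  have hzero : (Polynomial.C (x (ℓ none)) + Polynomial.X * Polynomial.C (x₀ (ℓ none))) * P = 0 := by
    refine Polynomial.funext fun t => ?_
    have := h W (x + t • x₀)
    rw [flatFunctional_rename_some] at this
    rw [Polynomial.eval_mul, hP]
    simpa [mul_comm t] using this
  have hne : (Polynomial.C (x (ℓ none)) + Polynomial.X * Polynomial.C (x₀ (ℓ none))) ≠ 0 := by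
    intro hq
    have := congrArg (fun q => Polynomial.coeff q 1) hq
    simp [Polynomial.coeff_C] at this
    exact hx₀ this
  have hP0 : P = 0 := (mul_eq_zero.mp hzero).resolve_left hne
  have := hP 0
  rw [hP0] at this
  simpa using this.symm

/-- The family induced by `ℓ` in the quotient by the line through `ℓ none`. -/
def contractNone (ℓ : Option κ → M) (s : κ) : M ⧸ Submodule.span K {ℓ none} :=
  Submodule.Quotient.mk (ℓ (some s))

theorem finrank_comap_mkQ [FiniteDimensional K M] (L : Submodule K M) (W : Submodule K (M ⧸ L)) :
    Module.finrank K (W.comap L.mkQ) = Module.finrank K W + Module.finrank K L := by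
  have hle : L ≤ W.comap L.mkQ := by
    intro y hy
    rw [Submodule.mem_comap, Submodule.mkQ_apply, (Submodule.Quotient.mk_eq_zero L).mpr hy]
    exact W.zero_mem
  let φ : W.comap L.mkQ →ₗ[K] W := L.mkQ.restrict fun y hy => hy
  have h2 := LinearMap.finrank_range_add_finrank_ker φ
  have h3 : LinearMap.range φ = ⊤ := by
    rw [LinearMap.range_eq_top]
    rintro ⟨w, hw⟩
    obtain ⟨y, rfl⟩ := L.mkQ_surjective w
    exact ⟨⟨y, hw⟩, rfl⟩
  have h4 : LinearMap.ker φ = L.comap (W.comap L.mkQ).subtype := by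
    ext ⟨y, hy⟩
    simp [φ, LinearMap.mem_ker, Subtype.ext_iff]
  have h5 : Module.finrank K (LinearMap.ker φ) = Module.finrank K L := by
    rw [h4]
    exact (Submodule.comapSubtypeEquivOfLe hle).finrank_eq
  rw [h3, h5, finrank_top] at h2
  exact h2.symm

theorem isBasisOf_comap [FiniteDimensional K M] {ℓ : Option κ → M} (h0 : ℓ none ≠ 0)
    (W : Submodule K (M ⧸ Submodule.span K {ℓ none})) (S : Finset κ) :
    IsBasisOf ℓ (W.comap (Submodule.mkQ _)) (Finset.insertNone S) ↔
      IsBasisOf (contractNone (K := K) ℓ) W S := by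
  have hspan : Submodule.span K (ℓ '' (Finset.insertNone S : Finset (Option κ))) =
      (Submodule.span K (contractNone (K := K) ℓ '' S)).comap (Submodule.mkQ _) := by
    have h1 : contractNone (K := K) ℓ '' S =
        Submodule.mkQ (Submodule.span K {ℓ none}) '' ((fun s => ℓ (some s)) '' S) := by
      rw [Set.image_image]; rfl
    rw [h1, ← Submodule.map_span, Submodule.comap_map_mkQ, ← Submodule.span_union]
    congr 1
    ext y
    simp [Option.exists, eq_comm]
  have hinj := Submodule.comap_injective_of_surjective
    (Submodule.mkQ_surjective (Submodule.span K {ℓ none}))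
  rw [IsBasisOf, IsBasisOf, hspan, finrank_comap_mkQ, finrank_span_singleton h0, hinj.eq_iff,
    Finset.card_insertNone]
  simp

/-- Pull `W` and `x` back along the quotient map. The pulled-back `x` kills `ℓ none`, so only sets
containing `none` contribute, and among these the bases of the preimage of `W` correspond to bases
of `W`. -/
theorem KilledByFlats.contractNone [FiniteDimensional K M] [Fintype κ] [DecidableEq κ]
    {ℓ : Option κ → M} (h0 : ℓ none ≠ 0) {f : MvPolynomial (Option κ) K}
    (h : KilledByFlats ℓ f) :
    KilledByFlats (contractNone (K := K) ℓ) ((optionEquivLeft K κ f).coeff 1) := by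
  classical
  intro W x
  have := h (W.comap (Submodule.mkQ _)) (x.comp (Submodule.mkQ _))
  rw [flatFunctional_apply, sum_finset_option] at this
  rw [flatFunctional_apply]
  refine Eq.trans ?_ this
  have hx : x (Submodule.Quotient.mk (ℓ none) : M ⧸ Submodule.span K {ℓ none}) = 0 := by
    rw [(Submodule.Quotient.mk_eq_zero _).mpr (Submodule.mem_span_singleton_self _), map_zero]
  refine (zero_add _).symm.trans (congrArg₂ (· + ·) (Finset.sum_eq_zero ?_).symm
    (Finset.sum_congr rfl ?_))
  · intro S _
    have : (none : Option κ) ∈ (S.map Function.Embedding.some)ᶜ := by simp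
    rw [Finset.prod_eq_zero this (by simpa using hx)]
    simp
  · intro S _
    have hc : (Finset.insertNone S)ᶜ = Sᶜ.map Function.Embedding.some := by
      ext (_ | s) <;> simp
    simp only [isBasisOf_comap h0, optionEquivLeft_coeff_coeff, optionElim_squarefreeExp, hc,
      Finset.prod_map]
    rfl

end DeletionContraction

/-! ### Membership in the Artinian Orlik-Terao ideal. -/

section AOTIdeal

variable {K : Type*} [Field K] {ι κ M : Type*} [AddCommGroup M] [Module K M]

theorem relation_mem_aotIdeal [DecidableEq ι] {ℓ : ι → M} {Λ : Finset ι} {c : ι → K}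
    (h : ∑ t ∈ Λ, c t • ℓ t = 0) :
    ∑ t ∈ Λ, C (c t) * ∏ s ∈ Λ.erase t, X s ∈ aotIdeal K ℓ :=
  Ideal.mem_sup_left (Ideal.subset_span ⟨Λ, c, h, rfl⟩)

theorem X_sq_mem_aotIdeal [DecidableEq ι] (ℓ : ι → M) (i : ι) :
    (X i ^ 2 : MvPolynomial ι K) ∈ aotIdeal K ℓ :=
  Ideal.mem_sup_right (Ideal.subset_span ⟨i, rfl⟩)

theorem aotIdeal_induction [DecidableEq ι] {ℓ : ι → M} {P : MvPolynomial ι K → Prop}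
    (h_rel : ∀ (Λ : Finset ι) (c : ι → K), ∑ t ∈ Λ, c t • ℓ t = 0 →
      P (∑ t ∈ Λ, C (c t) * ∏ s ∈ Λ.erase t, X s))
    (h_sq : ∀ i, P (X i ^ 2)) (h_zero : P 0) (h_add : ∀ f g, P f → P g → P (f + g))
    (h_mul : ∀ p f, P f → P (p * f)) {f : MvPolynomial ι K} (hf : f ∈ aotIdeal K ℓ) : P f := by
  rw [aotIdeal, orlikTeraoIdeal, ← Ideal.span_union] at hf
  induction hf using Submodule.span_induction with
  | zero => exact h_zero
  | add f g _ _ hf hg => exact h_add _ _ hf hg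
  | smul q f _ hf => exact h_mul _ _ hf
  | mem f hf =>
    rcases hf with ⟨Λ, c, h, rfl⟩ | ⟨i, rfl⟩
    · exact h_rel Λ c h
    · exact h_sq i

/-- A loop is a relation on the single index `i`, and its generator is an empty product. -/
theorem aotIdeal_eq_top [DecidableEq ι] {ℓ : ι → M} {i : ι} (h : ℓ i = 0) : aotIdeal K ℓ = ⊤ := by
  rw [Ideal.eq_top_iff_one]
  simpa using relation_mem_aotIdeal (K := K) (ℓ := ℓ) (Λ := {i}) (c := 1) (by simp [h])

theorem rename_mem_aotIdeal [DecidableEq ι] [DecidableEq κ] {ℓ : ι → M} {j : κ → ι}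
    (hj : Function.Injective j) {g : MvPolynomial κ K}
    (hg : g ∈ aotIdeal K (fun s => ℓ (j s))) : rename j g ∈ aotIdeal K ℓ := by
  refine aotIdeal_induction (P := fun g => rename j g ∈ aotIdeal K ℓ) (fun Λ c h => ?_)
    (fun i => ?_) ?_ (fun f g hf hg => ?_) (fun p f hf => ?_) hg
  · have := relation_mem_aotIdeal (K := K) (ℓ := ℓ) (Λ := Λ.map ⟨j, hj⟩)
      (c := Function.extend j c 0) (by simpa [hj.extend_apply] using h)
    have hE : ∀ t, (Λ.map ⟨j, hj⟩).erase (j t) = (Λ.erase t).map ⟨j, hj⟩ := fun t =>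
      (Finset.map_erase ⟨j, hj⟩ Λ t).symm
    simp only [Finset.sum_map, Function.Embedding.coeFn_mk, hE, Finset.prod_map,
      hj.extend_apply] at this
    simpa only [map_sum, map_mul, map_prod, rename_X, rename_C] using this
  · simpa using X_sq_mem_aotIdeal ℓ (j i)
  · simp
  · rw [map_add]; exact Ideal.add_mem _ hf hg
  · rw [map_mul]; exact Ideal.mul_mem_left _ _ hf

theorem homogeneousComponent_mem_aotIdeal [DecidableEq ι] {ℓ : ι → M} {f : MvPolynomial ι K}
    (hf : f ∈ aotIdeal K ℓ) (n : ℕ) : homogeneousComponent n f ∈ aotIdeal K ℓ := by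
  let _ : GradedAlgebra (homogeneousSubmodule ι K) := gradedAlgebra
  have hI : (aotIdeal K ℓ).IsHomogeneous (homogeneousSubmodule ι K) := by
    rw [aotIdeal, orlikTeraoIdeal, ← Ideal.span_union]
    refine Ideal.homogeneous_span _ _ ?_
    rintro f (⟨Λ, c, -, rfl⟩ | ⟨i, rfl⟩)
    · refine ⟨Λ.card - 1, IsHomogeneous.sum _ _ _ fun t ht => ?_⟩
      rw [← Finset.card_erase_of_mem ht]
      refine IsHomogeneous.C_mul ?_ _
      simpa using IsHomogeneous.prod (Λ.erase t) (fun s => (X s : MvPolynomial ι K)) (fun _ => 1)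
        fun s _ => isHomogeneous_X K s
    · exact ⟨2, isHomogeneous_X_pow _ _⟩
  exact homogeneousComponent_mem_of_mem hI hf n

theorem exists_isHomogeneous_of_mem_sup_span [DecidableEq ι] {ℓ : ι → M} {L f : MvPolynomial ι K}
    {n : ℕ} (hL : L.IsHomogeneous 1) (hf : f.IsHomogeneous n)
    (h : f ∈ aotIdeal K ℓ ⊔ Ideal.span {L}) :
    ∃ g ∈ aotIdeal K ℓ, g.IsHomogeneous n ∧ f - g ∈ Ideal.span {L} := by
  obtain ⟨g, hg, q, hq, rfl⟩ := Submodule.mem_sup.mp h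
  refine ⟨homogeneousComponent n g, homogeneousComponent_mem_aotIdeal hg n,
    homogeneousComponent_isHomogeneous n g, ?_⟩
  let _ : GradedAlgebra (homogeneousSubmodule ι K) := gradedAlgebra
  have hI : (Ideal.span {L}).IsHomogeneous (homogeneousSubmodule ι K) := by
    refine Ideal.homogeneous_span _ _ ?_
    rintro f rfl
    exact ⟨1, hL⟩
  have := homogeneousComponent_mem_of_mem hI hq n
  rw [← homogeneousComponent_eq_self hf, map_add, add_sub_cancel_left]
  exact this

/-- A relation of the contraction lifts to `∑ c t • ℓ (some t) = a • ℓ none`. The generator of this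
relation on `insertNone Λ` is the old generator times `X none`, minus `a` times the product over
`Λ`; the last term is free of `X none`. So, modulo the ideal, multiplying an element of the
contracted ideal by `X none` lands in the subring of the deletion. -/
theorem exists_X_none_mul_sub_rename_mem [DecidableEq κ] {ℓ : Option κ → M}
    {g : MvPolynomial κ K} (hg : g ∈ aotIdeal K (contractNone (K := K) ℓ)) :
    ∃ h, X none * rename some g - rename some h ∈ aotIdeal K ℓ := by
  refine aotIdeal_induction
    (P := fun g => ∃ h, X none * rename some g - rename some h ∈ aotIdeal K ℓ)
    (fun Λ c h => ?_) (fun i => ?_) ?_ (fun f g hf hg => ?_) (fun p f hf => ?_) hg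
  · have h' : (Submodule.Quotient.mk (∑ t ∈ Λ, c t • ℓ (some t)) : M ⧸ Submodule.span K {ℓ none}) =
        0 := by
      rw [← h, ← Submodule.mkQ_apply, map_sum]
      simp [contractNone]
    rw [Submodule.Quotient.mk_eq_zero, Submodule.mem_span_singleton] at h'
    obtain ⟨a, ha⟩ := h'
    refine ⟨C a * ∏ s ∈ Λ, X s, ?_⟩
    have := relation_mem_aotIdeal (K := K) (ℓ := ℓ) (Λ := Finset.insertNone Λ)
      (c := fun o => o.elim (-a) c) (by simp [Finset.sum_insertNone, ha])
    convert this using 1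
    have h1 : (Finset.insertNone Λ).erase none = Λ.map .some := by ext (_ | s) <;> simp
    have h2 : ∀ t, (Finset.insertNone Λ).erase (some t) = Finset.insertNone (Λ.erase t) := by
      intro t; ext (_ | s) <;> simp
    simp only [Finset.sum_insertNone, h1, h2, Finset.prod_insertNone, Finset.prod_map, map_sum,
      map_mul, map_prod, rename_X, Finset.mul_sum, Option.elim, map_neg, algHom_C]
    rw [sub_eq_neg_add]
    simp only [algebraMap_eq, Function.Embedding.some_apply, neg_mul]
    refine congrArg₂ (· + ·) rfl (Finset.sum_congr rfl fun t _ => ?_)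
    ring
  · refine ⟨0, ?_⟩
    simpa using Ideal.mul_mem_left _ (X none) (X_sq_mem_aotIdeal (K := K) ℓ (some i))
  · exact ⟨0, by simp⟩
  · obtain ⟨p, hp⟩ := hf
    obtain ⟨q, hq⟩ := hg
    refine ⟨p + q, ?_⟩
    convert Ideal.add_mem _ hp hq using 1
    simp only [map_add]
    ring
  · obtain ⟨q, hq⟩ := hf
    refine ⟨p * q, ?_⟩
    convert Ideal.mul_mem_left _ (rename some p) hq using 1
    simp only [map_mul]
    ring

theorem exists_isHomogeneous_X_none_mul_sub_rename_mem [DecidableEq κ] {ℓ : Option κ → M}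
    {g : MvPolynomial κ K} {n : ℕ} (hn : (X none * rename some g).IsHomogeneous n)
    (hg : g ∈ aotIdeal K (contractNone (K := K) ℓ)) :
    ∃ h : MvPolynomial κ K, h.IsHomogeneous n ∧
      X none * rename some g - rename some h ∈ aotIdeal K ℓ := by
  obtain ⟨h, hh⟩ := exists_X_none_mul_sub_rename_mem hg
  refine ⟨homogeneousComponent n h, homogeneousComponent_isHomogeneous n h, ?_⟩
  have := homogeneousComponent_mem_aotIdeal hh n
  rwa [map_sub, homogeneousComponent_eq_self hn, ← rename_homogeneousComponent] at this

end AOTIdeal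

/-! ### Splitting a polynomial by powers of the variable `none`. -/

section OptionDecomposition

variable {K : Type*} [Field K] {κ : Type*}

/-- The part of a polynomial free of the variable `none`. -/
def constPart (f : MvPolynomial (Option κ) K) : MvPolynomial κ K := (optionEquivLeft K κ f).coeff 0

/-- The coefficient of the first power of the variable `none`. -/
def linPart (f : MvPolynomial (Option κ) K) : MvPolynomial κ K := (optionEquivLeft K κ f).coeff 1

theorem optionEquivLeft_rename_some (g : MvPolynomial κ K) :
    optionEquivLeft K κ (rename some g) = Polynomial.C g := by
  induction g using MvPolynomial.induction_on with
  | C a => simp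
  | add p q hp hq => simp [hp, hq]
  | mul_X p i hp => simp [hp]

theorem linPart_rename_mul (L : MvPolynomial κ K) (f : MvPolynomial (Option κ) K) :
    linPart (rename some L * f) = L * linPart f := by
  simp [linPart, optionEquivLeft_rename_some]

theorem exists_eq_constPart_add_linPart (f : MvPolynomial (Option κ) K) :
    ∃ q, f = rename some (constPart f) + X none * rename some (linPart f) + X none ^ 2 * q := by
  refine ⟨(optionEquivLeft K κ).symm (optionEquivLeft K κ f).divX.divX, ?_⟩
  apply (optionEquivLeft K κ).injective
  simp only [map_add, map_mul, map_pow, optionEquivLeft_rename_some, optionEquivLeft_X_none,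
    AlgEquiv.apply_symm_apply, constPart, linPart]
  conv_lhs => rw [← Polynomial.divX_mul_X_add (optionEquivLeft K κ f),
    ← Polynomial.divX_mul_X_add (optionEquivLeft K κ f).divX]
  rw [Polynomial.coeff_divX]
  ring

theorem sub_mem_aotIdeal_of_option {M : Type*} [AddCommGroup M] [Module K M] [DecidableEq κ]
    (ℓ : Option κ → M) (f : MvPolynomial (Option κ) K) :
    f - (rename some (constPart f) + X none * rename some (linPart f)) ∈ aotIdeal K ℓ := by
  obtain ⟨q, hq⟩ := exists_eq_constPart_add_linPart f
  have : f - (rename some (constPart f) + X none * rename some (linPart f)) = q * X none ^ 2 := by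
    linear_combination hq
  rw [this]
  exact Ideal.mul_mem_left _ _ (X_sq_mem_aotIdeal ℓ none)

theorem degree_optionElim (m : ℕ) (d : κ →₀ ℕ) : (d.optionElim m).degree = m + d.degree := by
  have : d.optionElim m = Finsupp.single none m + d.mapDomain some := by
    ext (_ | s)
    · simp [Finsupp.mapDomain_of_notMem_range]
    · simp [Finsupp.mapDomain_apply (Option.some_injective κ)]
  rw [this, map_add, Finsupp.degree_single, Finsupp.degree_mapDomain]

theorem constPart_isHomogeneous {f : MvPolynomial (Option κ) K} {n : ℕ} (hf : f.IsHomogeneous n) :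
    (constPart f).IsHomogeneous n := by
  intro d hd
  rw [constPart, optionEquivLeft_coeff_coeff] at hd
  have : (Finsupp.weight fun _ => 1) _ = _ := hf hd
  change (Finsupp.weight fun _ => 1) d = n
  rw [← Finsupp.degree_eq_weight_one] at this ⊢
  simpa [degree_optionElim] using this

theorem linPart_isHomogeneous {f : MvPolynomial (Option κ) K} {n : ℕ}
    (hf : f.IsHomogeneous (n + 1)) : (linPart f).IsHomogeneous n := by
  intro d hd
  rw [linPart, optionEquivLeft_coeff_coeff] at hd
  have : (Finsupp.weight fun _ => 1) _ = _ := hf hd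
  change (Finsupp.weight fun _ => 1) d = n
  rw [← Finsupp.degree_eq_weight_one] at this ⊢
  rw [degree_optionElim] at this
  omega

theorem linPart_eq_zero {f : MvPolynomial (Option κ) K} (hf : f.IsHomogeneous 0) :
    linPart f = 0 := by
  ext d
  rw [linPart, optionEquivLeft_coeff_coeff, coeff_zero]
  refine hf.coeff_eq_zero ?_
  rw [degree_optionElim]
  omega

end OptionDecomposition

/-! ### The inductive step for one chord. -/

section Steps

variable {K : Type*} [Field K] {ι κ M : Type*} [AddCommGroup M] [Module K M]

/-- Multiplication by `L` is injective on the degree `n` part of the Artinian Orlik-Terao algebra,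
even when its values are only tested against the functionals attached to flats. -/
def FlatInjective [Fintype ι] [DecidableEq ι] (ℓ : ι → M) (L : MvPolynomial ι K) (n : ℕ) : Prop :=
  ∀ f : MvPolynomial ι K, f.IsHomogeneous n → KilledByFlats ℓ (L * f) → f ∈ aotIdeal K ℓ

/-- The quotient of the Artinian Orlik-Terao algebra by `L` vanishes in degree `n`. -/
def CokernelVanishes [DecidableEq ι] (ℓ : ι → M) (L : MvPolynomial ι K) (n : ℕ) : Prop :=
  ∀ g : MvPolynomial ι K, g.IsHomogeneous n → g ∈ aotIdeal K ℓ ⊔ Ideal.span {L}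

/-- Modulo the square of `X none`, write f = f₀ + y f₁. The contraction hypothesis puts f₁ in the
contracted ideal, so y f₁ can be traded for some h free of y. Then f ≡ f₀ + h comes from the
deletion, whose hypothesis finishes. Working with killed polynomials instead of ideal members is
what makes both transfers available. -/
theorem FlatInjective.option [Infinite K] [FiniteDimensional K M] [Fintype κ] [DecidableEq κ]
    {ℓ : Option κ → M} (h0 : ℓ none ≠ 0) {L : MvPolynomial κ K} {n : ℕ}
    (hdel : FlatInjective (fun s => ℓ (some s)) L n)
    (hcon : ∀ m, m + 1 = n → FlatInjective (contractNone (K := K) ℓ) L m) :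
    FlatInjective ℓ (rename some L) n := by
  intro f hf hkill
  have hlin : linPart f ∈ aotIdeal K (contractNone (K := K) ℓ) := by
    cases n with
    | zero => rw [linPart_eq_zero hf]; exact Ideal.zero_mem _
    | succ m =>
      refine hcon m rfl _ (linPart_isHomogeneous hf) ?_
      rw [← linPart_rename_mul]
      exact hkill.contractNone h0
  have hX : (X none * rename some (linPart f) : MvPolynomial (Option κ) K).IsHomogeneous n := by
    cases n with
    | zero => rw [linPart_eq_zero hf]; simpa using isHomogeneous_zero _ _ _
    | succ m =>
      rw [add_comm]
      exact (isHomogeneous_X _ _).mul (linPart_isHomogeneous hf).rename_isHomogeneous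
  obtain ⟨h, hhom, hh⟩ := exists_isHomogeneous_X_none_mul_sub_rename_mem hX hlin
  have hred : f - rename some (constPart f + h) ∈ aotIdeal K ℓ := by
    convert Ideal.add_mem _ (sub_mem_aotIdeal_of_option ℓ f) hh using 1
    rw [map_add]
    ring
  have hdel' : constPart f + h ∈ aotIdeal K (fun s => ℓ (some s)) := by
    refine hdel _ ((constPart_isHomogeneous hf).add hhom) (KilledByFlats.of_rename_some h0 ?_)
    have h1 := hkill.add (killedByFlats_of_mem_aotIdeal
      (Ideal.mul_mem_left _ (-rename some L) hred))
    convert h1 using 1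
    rw [map_mul]
    ring
  have := Ideal.add_mem _ hred (rename_mem_aotIdeal (Option.some_injective κ) hdel')
  simpa using this

/-- Same elimination of `X none`, now modulo `L` as well; no functionals are needed, because the
ideals of deletion and contraction only have to map forwards. -/
theorem CokernelVanishes.option [DecidableEq κ] {ℓ : Option κ → M} {L : MvPolynomial κ K}
    (hL : L.IsHomogeneous 1) {n : ℕ}
    (hdel : CokernelVanishes (fun s => ℓ (some s)) L n)
    (hcon : ∀ m, m + 1 = n → CokernelVanishes (contractNone (K := K) ℓ) L m) :
    CokernelVanishes ℓ (rename some L) n := by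
  intro g hg
  have hspan : ∀ q ∈ Ideal.span {L}, rename some q ∈ Ideal.span {rename some L} := by
    intro q hq
    rw [Ideal.mem_span_singleton] at hq ⊢
    exact map_dvd _ hq
  have hlin : ∃ h : MvPolynomial κ K, h.IsHomogeneous n ∧ X none * rename some (linPart g) -
      rename some h ∈ aotIdeal K ℓ ⊔ Ideal.span {rename some L} := by
    cases n with
    | zero => exact ⟨0, isHomogeneous_zero _ _ _, by rw [linPart_eq_zero hg]; simp⟩
    | succ m =>
      obtain ⟨q, hq, hqm, hqL⟩ := exists_isHomogeneous_of_mem_sup_span hL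
        (linPart_isHomogeneous hg) (hcon m rfl _ (linPart_isHomogeneous hg))
      obtain ⟨h, hhom, hh⟩ := exists_isHomogeneous_X_none_mul_sub_rename_mem (n := m + 1)
        (by rw [add_comm]; exact (isHomogeneous_X _ _).mul hqm.rename_isHomogeneous) hq
      refine ⟨h, hhom, ?_⟩
      have h1 := Ideal.mul_mem_left _ (X none) (hspan _ hqL)
      convert Ideal.add_mem _ (Ideal.mem_sup_left hh) (Ideal.mem_sup_right h1) using 1
      rw [map_sub]
      ring
  obtain ⟨h, hhom, hh⟩ := hlin
  have hdel' : rename some (constPart g + h) ∈ aotIdeal K ℓ ⊔ Ideal.span {rename some L} := by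
    obtain ⟨p, hp, q, hq, hpq⟩ :=
      Submodule.mem_sup.mp (hdel _ ((constPart_isHomogeneous hg).add hhom))
    rw [← hpq, map_add]
    exact Ideal.add_mem _
      (Ideal.mem_sup_left (rename_mem_aotIdeal (Option.some_injective κ) hp))
      (Ideal.mem_sup_right (hspan _ hq))
  convert Ideal.add_mem _ (Ideal.add_mem _ (Ideal.mem_sup_left (sub_mem_aotIdeal_of_option ℓ g)) hh)
    hdel' using 1
  rw [map_add]
  ring

theorem KilledByFlats.of_rename_equiv [Fintype ι] [DecidableEq ι] [Fintype κ] [DecidableEq κ]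
    {ℓ : ι → M} (σ : κ ≃ ι) {g : MvPolynomial κ K} (h : KilledByFlats ℓ (rename σ g)) :
    KilledByFlats (fun s => ℓ (σ s)) g := by
  classical
  intro W x
  have := h W x
  rw [flatFunctional_apply, ← σ.finsetCongr.sum_comp] at this
  rw [flatFunctional_apply]
  refine Eq.trans (Finset.sum_congr rfl fun S _ => ?_) this
  have hc : (S.map σ.toEmbedding)ᶜ = Sᶜ.map σ.toEmbedding := by
    ext s
    simp [Finset.mem_map_equiv]
  have hb : IsBasisOf ℓ W (S.map σ.toEmbedding) ↔ IsBasisOf (fun s => ℓ (σ s)) W S := by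
    simp [IsBasisOf, Set.image_image]
  have h1 : coeff (squarefreeExp (S.map σ.toEmbedding)) (rename σ g) =
      coeff (squarefreeExp S) g := by
    rw [squarefreeExp_map]
    exact coeff_rename_mapDomain _ σ.injective _ _
  simp only [Equiv.finsetCongr_apply, hb, h1, hc, Finset.prod_map]
  rfl

theorem FlatInjective.of_equiv [Fintype ι] [DecidableEq ι] [Fintype κ] [DecidableEq κ]
    {ℓ : ι → M} (σ : κ ≃ ι) {L : MvPolynomial κ K} {n : ℕ}
    (h : FlatInjective (fun s => ℓ (σ s)) L n) : FlatInjective ℓ (rename σ L) n := by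
  intro f hf hkill
  have hff : rename σ (rename σ.symm f) = f := by simp [rename_rename]
  rw [← hff] at hkill ⊢
  rw [← map_mul] at hkill
  exact rename_mem_aotIdeal σ.injective (h _ hf.rename_isHomogeneous hkill.of_rename_equiv)

theorem CokernelVanishes.of_equiv [DecidableEq ι] [DecidableEq κ]
    {ℓ : ι → M} (σ : κ ≃ ι) {L : MvPolynomial κ K} {n : ℕ}
    (h : CokernelVanishes (fun s => ℓ (σ s)) L n) : CokernelVanishes ℓ (rename σ L) n := by
  intro f hf
  have hff : rename σ (rename σ.symm f) = f := by simp [rename_rename]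
  obtain ⟨p, hp, q, hq, hpq⟩ := Submodule.mem_sup.mp (h _ hf.rename_isHomogeneous)
  rw [← hff, ← hpq, map_add]
  refine Ideal.add_mem _ (Ideal.mem_sup_left (rename_mem_aotIdeal σ.injective hp))
    (Ideal.mem_sup_right ?_)
  rw [Ideal.mem_span_singleton] at hq ⊢
  exact map_dvd _ hq

end Steps

/-! ### Reading off coefficients of polynomials killed by flats. -/

section CoefficientExtraction

variable {K : Type*} [Field K] {ι M : Type*} [AddCommGroup M] [Module K M]

/-- The linear form `∑ a_i y_i`. -/
def linForm [Fintype ι] (a : ι → K) : MvPolynomial ι K := ∑ i, C (a i) * X i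

theorem linForm_isHomogeneous [Fintype ι] (a : ι → K) : (linForm a).IsHomogeneous 1 :=
  IsHomogeneous.sum _ _ _ fun _ _ => isHomogeneous_C_mul_X _ _

theorem coeff_linForm_mul [Fintype ι] [DecidableEq ι] (a : ι → K) (f : MvPolynomial ι K)
    (T : Finset ι) : coeff (squarefreeExp T) (linForm a * f) =
      ∑ i ∈ T, a i * coeff (squarefreeExp (T.erase i)) f := by
  rw [linForm, Finset.sum_mul, coeff_sum]
  have : ∀ i, coeff (squarefreeExp T) (C (a i) * X i * f) =
      if i ∈ T then a i * coeff (squarefreeExp (T.erase i)) f else 0 := by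
    intro i
    rw [mul_assoc, coeff_C_mul, coeff_X_mul']
    have h1 : i ∈ (squarefreeExp T).support ↔ i ∈ T := by
      simp [squarefreeExp_apply]
    by_cases hi : i ∈ T
    · rw [if_pos (h1.mpr hi), if_pos hi]
      have : squarefreeExp T - Finsupp.single i 1 = squarefreeExp (T.erase i) := by
        ext s
        by_cases hs : s = i
        · subst hs; simp [squarefreeExp_apply, hi]
        · simp [squarefreeExp_apply, hs]
      rw [this]
    · rw [if_neg (mt h1.mp hi), if_neg hi, mul_zero]
  simp only [this]
  simp

theorem mem_of_squarefree_coeff_mem {J : Ideal (MvPolynomial ι K)} (hJ : ∀ i, X i ^ 2 ∈ J)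
    {f : MvPolynomial ι K} {n : ℕ} (hf : f.IsHomogeneous n)
    (h : ∀ S : Finset ι, S.card = n → C (coeff (squarefreeExp S) f) * ∏ s ∈ S, X s ∈ J) :
    f ∈ J := by
  rw [f.as_sum]
  refine Ideal.sum_mem _ fun d hd => ?_
  by_cases hd2 : ∃ i, 2 ≤ d i
  · obtain ⟨i, hi⟩ := hd2
    have : d = (d - Finsupp.single i 2) + Finsupp.single i 2 :=
      (tsub_add_cancel_of_le (by simpa using hi)).symm
    rw [this, ← mul_one (coeff _ f), ← monomial_mul]
    exact Ideal.mul_mem_left _ _ (by simpa [X_pow_eq_monomial] using hJ i)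
  · push Not at hd2
    obtain ⟨S, rfl⟩ := exists_eq_squarefreeExp d hd2
    have hc : S.card = n := by
      rw [← degree_squarefreeExp]
      by_contra hne
      exact (mem_support_iff.mp hd) (hf.coeff_eq_zero hne)
    have := h S hc
    rwa [prod_X_eq_monomial, C_mul_monomial, mul_one] at this

/-- If `T` is the set of indices in a flat `W`, then the functional of `W` only involves subsets
of `T`. -/
theorem KilledByFlats.sum_powersetCard_eq_zero [Fintype ι] [DecidableEq ι] {ℓ : ι → M}
    {f : MvPolynomial ι K} (hf : KilledByFlats ℓ f) {W : Submodule K M} {T : Finset ι}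
    (hT : ∀ s, ℓ s ∈ W → s ∈ T) {x : Module.Dual K M} (hx : ∀ s ∉ T, x (ℓ s) ≠ 0) {n : ℕ}
    (hn : Module.finrank K W = n) {c : Finset ι → K}
    (hc : ∀ S ∈ T.powersetCard n, (Submodule.span K (ℓ '' S) = W ∧
      c S = ∏ s ∈ T \ S, x (ℓ s)) ∨ (Submodule.span K (ℓ '' S) ≠ W ∧ c S = 0)) :
    ∑ S ∈ T.powersetCard n, c S * coeff (squarefreeExp S) f = 0 := by
  classical
  have h := hf W x
  rw [flatFunctional_apply, ← Finset.sum_subset (Finset.subset_univ (T.powersetCard n))] at h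
  · have key : ∀ S ∈ T.powersetCard n,
        (if IsBasisOf ℓ W S then ∏ s ∈ Sᶜ, x (ℓ s) else 0) * coeff (squarefreeExp S) f =
        (∏ s ∈ Tᶜ, x (ℓ s)) * (c S * coeff (squarefreeExp S) f) := by
      intro S hS
      obtain ⟨hST, hcard⟩ := Finset.mem_powersetCard.mp hS
      rcases hc S hS with ⟨h1, h2⟩ | ⟨h1, h2⟩
      · rw [if_pos ⟨h1, hcard.trans hn.symm⟩, h2, ← mul_assoc, ← Finset.prod_union]
        · congr 2
          ext s
          have := @hST s
          simp only [Finset.mem_compl, Finset.mem_union, Finset.mem_sdiff]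
          tauto
        · rw [Finset.disjoint_left]
          simp +contextual
      · rw [if_neg fun hb => h1 hb.1, h2]
        simp
    -- Indices outside `T` lie in every complement; their common factor is nonzero by `hx` and
    -- cancels.
    rw [Finset.sum_congr rfl key, ← Finset.mul_sum] at h
    refine (mul_eq_zero.mp h).resolve_left (Finset.prod_ne_zero_iff.mpr fun s hs => hx s ?_)
    simpa using hs
  · intro S _ hS
    rw [if_neg, zero_mul]
    rintro ⟨h1, h2⟩
    refine hS (Finset.mem_powersetCard.mpr ⟨fun s hs => hT s ?_, h2.trans hn⟩)
    rw [← h1]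
    exact Submodule.subset_span ⟨s, hs, rfl⟩

theorem finrank_span_image_of_indep {ℓ : ι → M} {T : Finset ι}
    (h : ∀ b : ι → K, ∑ i ∈ T, b i • ℓ i = 0 → ∀ i ∈ T, b i = 0) :
    Module.finrank K (Submodule.span K (ℓ '' T)) = T.card := by
  have hli : LinearIndepOn K ℓ (T : Set ι) := linearIndepOn_finset_iff.mpr h
  have := finrank_span_eq_card (R := K) hli.linearIndependent
  rw [← Set.image_eq_range] at this
  simpa using this

theorem not_mem_span_image_of_indep [Fintype ι] [DecidableEq ι] {ℓ : ι → M} {T : Finset ι} {s : ι}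
    (hs : s ∉ T) (h : ∀ b : ι → K, b s = -1 → (∀ i, i ∉ insert s T → b i = 0) →
      ∑ i, b i • ℓ i ≠ 0) : ℓ s ∉ Submodule.span K (ℓ '' T) := by
  intro hmem
  obtain ⟨c, hc⟩ := (Submodule.mem_span_image_finset_iff_exists_fun K).mp hmem
  refine h (fun i => if hi : i ∈ T then c ⟨i, hi⟩ else if i = s then -1 else 0) (by simp [hs]) ?_ ?_
  · intro i hi
    simp only [Finset.mem_insert, not_or] at hi
    simp [hi.1, hi.2]
  · rw [← Finset.sum_subset (Finset.subset_univ (insert s T)), Finset.sum_insert hs, dif_neg hs,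
      if_pos rfl, ← hc, ← Finset.sum_coe_sort T]
    · simp
    · intro i _ hi
      simp only [Finset.mem_insert, not_or] at hi
      simp [hi.1, hi.2]

/-- If the vectors indexed by `T` stay independent after adding any further vector of the family,
then elements killed by the flats have no `T`-coefficient. -/
theorem KilledByFlats.coeff_eq_zero [Infinite K] [Fintype ι] [DecidableEq ι] [Nonempty ι]
    {ℓ : ι → M} {f : MvPolynomial ι K} (hf : KilledByFlats ℓ f) {T : Finset ι}
    (h : ∀ s, ∀ b : ι → K, (∀ i, i ∉ insert s T → b i = 0) → ∑ i, b i • ℓ i = 0 → b = 0) :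
    coeff (squarefreeExp T) f = 0 := by
  have hne : ∀ s, ℓ s ≠ 0 := by
    intro s hs
    have := h s (Pi.single s 1) (fun i hi => by
      simp only [Finset.mem_insert, not_or] at hi
      simp [hi.1]) (by simp [Pi.single_apply, hs])
    simpa using congrFun this s
  -- A point off all the hyperplanes; here `T` is the only basis of its span, so the functional
  -- reads a single coefficient.
  obtain ⟨x, hx⟩ := Module.exists_dual_forall_apply_ne_zero (K := K) ℓ hne
  have hind : ∀ b : ι → K, ∑ i ∈ T, b i • ℓ i = 0 → ∀ i ∈ T, b i = 0 := by
    intro b hb i hi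
    have := h i (fun i => if i ∈ T then b i else 0) (fun i hi => by
      simp only [Finset.mem_insert, not_or] at hi
      simp [hi.2]) (by simpa [ite_smul] using hb)
    simpa [hi] using congrFun this i
  have hflat : ∀ s, ℓ s ∈ Submodule.span K (ℓ '' T) → s ∈ T := by
    intro s hs
    by_contra hsT
    refine not_mem_span_image_of_indep hsT (fun b hbs hb hsum => ?_) hs
    rw [h s b hb hsum] at hbs
    simp at hbs
  have := hf.sum_powersetCard_eq_zero hflat (fun s _ => hx s) (finrank_span_image_of_indep hind)
    (c := fun _ => 1) (by simp [Finset.powersetCard_self])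
  simpa [Finset.powersetCard_self] using this

end CoefficientExtraction

/-! ### Injectivity for the contracted five-cycles. -/

section FiveCycleInjective

variable {K : Type*} [Field K] {M : Type*} [AddCommGroup M] [Module K M]

/-- The five vectors satisfy only the relation `∑ z_i = 0`. -/
def IsFiveCycle (K : Type*) [Field K] {M : Type*} [AddCommGroup M] [Module K M]
    (z : Fin 5 → M) : Prop :=
  ∀ b : Fin 5 → K, ∑ i, b i • z i = 0 ↔ ∀ i, b i = b 0

/-- The relations between the five vectors are generated by `∑ z_i = 0` and `z_0 + z_1 = 0`. -/
def IsDigonTriangle (K : Type*) [Field K] {M : Type*} [AddCommGroup M] [Module K M]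
    (z : Fin 5 → M) : Prop :=
  ∀ b : Fin 5 → K, ∑ i, b i • z i = 0 ↔ b 0 = b 1 ∧ b 2 = b 3 ∧ b 3 = b 4

/-- The relations between the five vectors are generated by `∑ z_i = 0`, `z_0 + z_1 = 0` and
`z_1 + z_2 = 0`. -/
def IsTripleTriangle (K : Type*) [Field K] {M : Type*} [AddCommGroup M] [Module K M]
    (z : Fin 5 → M) : Prop :=
  ∀ b : Fin 5 → K, ∑ i, b i • z i = 0 ↔ b 3 = b 4 ∧ b 0 + b 2 = b 1 + b 3

theorem mem_aotIdeal_of_coeff_eq_zero {ι : Type*} [DecidableEq ι] {ℓ : ι → M}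
    {f : MvPolynomial ι K} {n : ℕ} (hf : f.IsHomogeneous n)
    (h : ∀ S : Finset ι, S.card = n → coeff (squarefreeExp S) f = 0) : f ∈ aotIdeal K ℓ :=
  mem_of_squarefree_coeff_mem (X_sq_mem_aotIdeal ℓ) hf fun S hS => by rw [h S hS]; simp

theorem exists_dual_of_injective {p q r : M}
    (h : ∀ b₀ b₁ b₂ : K, b₀ • p + b₁ • q + b₂ • r = 0 → b₀ = 0 ∧ b₁ = 0 ∧ b₂ = 0) (c₀ c₁ c₂ : K) :
    ∃ x : Module.Dual K M, x p = c₀ ∧ x q = c₁ ∧ x r = c₂ := by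
  let φ : (Fin 3 → K) →ₗ[K] M := Fintype.linearCombination K ![p, q, r]
  have hφ : LinearMap.ker φ = ⊥ := by
    rw [LinearMap.ker_eq_bot']
    intro b hb
    have := h (b 0) (b 1) (b 2)
      (by simpa [φ, Fintype.linearCombination_apply, Fin.sum_univ_three] using hb)
    ext i
    fin_cases i
    exacts [this.1, this.2.1, this.2.2]
  obtain ⟨g, hg⟩ := φ.exists_leftInverse_of_injective hφ
  have hv : ∀ i, g (![p, q, r] i) = Pi.single i 1 := by
    intro i
    have := LinearMap.congr_fun hg (Pi.single i 1)
    simpa [φ, Fintype.linearCombination_apply_single] using this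
  refine ⟨(Fintype.linearCombination K ![c₀, c₁, c₂]).comp g, ?_, ?_, ?_⟩
  · have := hv 0
    simp only [Matrix.cons_val] at this
    simp [this, Fintype.linearCombination_apply_single]
  · have := hv 1
    simp only [Matrix.cons_val] at this
    simp [this, Fintype.linearCombination_apply_single]
  · have := hv 2
    simp only [Matrix.cons_val] at this
    simp [this, Fintype.linearCombination_apply_single]

theorem IsDigonTriangle.add_eq_zero {z : Fin 5 → M} (hz : IsDigonTriangle K z) :
    z 0 + z 1 = 0 ∧ z 2 + z 3 + z 4 = 0 := by
  have h1 := (hz ![1, 1, 0, 0, 0]).mpr (by simp)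
  have h2 := (hz ![0, 0, 1, 1, 1]).mpr (by simp)
  simp [Fin.sum_univ_five] at h1 h2
  exact ⟨h1, h2⟩

/-- Any four of the five vectors are independent, so up to degree 3 the algebra is just the
squarefree algebra. -/
theorem IsFiveCycle.coeff_eq_zero [CharZero K] {z : Fin 5 → M} (hz : IsFiveCycle K z)
    {f : MvPolynomial (Fin 5) K} (hf : KilledByFlats z f) {T : Finset (Fin 5)} (hT : T.card ≤ 3) :
    coeff (squarefreeExp T) f = 0 := by
  refine hf.coeff_eq_zero fun s b hb hsum => ?_
  have hc := (hz b).mp hsum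
  have : ∃ i, i ∉ insert s T := by
    by_contra! hall
    have h1 : insert s T = Finset.univ := by ext i; simp [hall i]
    have h2 := Finset.card_insert_le s T
    rw [h1] at h2
    simp at h2
    omega
  obtain ⟨i, hi⟩ := this
  have h0 : b 0 = 0 := (hc i).symm.trans (hb i hi)
  ext j
  rw [hc j, h0]; rfl

/-- It suffices that one vector is parallel to no other: then the coefficient of `X i` in the
product, `a i` times the constant, is zero. -/
theorem flatInjective_zero [CharZero K] {z : Fin 5 → M} {a : Fin 5 → K} (i : Fin 5) (ha : a i ≠ 0)
    (h : ∀ s, ∀ b : Fin 5 → K, (∀ j, j ∉ insert s ({i} : Finset (Fin 5)) → b j = 0) → ∑ j, b j • z j = 0 → b = 0) :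
    FlatInjective z (linForm a) 0 := by
  intro f hf hkill
  refine mem_aotIdeal_of_coeff_eq_zero hf fun S hS => ?_
  obtain rfl := Finset.card_eq_zero.mp hS
  have := hkill.coeff_eq_zero (T := {i}) h
  rw [coeff_linForm_mul] at this
  simpa [ha] using this

/-- After dividing coefficients by the `a i`, any two of them are opposite; among three this forces
zero when 2 is invertible. -/
theorem IsFiveCycle.flatInjective_one [CharZero K] {z : Fin 5 → M} (hz : IsFiveCycle K z) {a : Fin 5 → K}
    (ha : ∀ i, a i ≠ 0) : FlatInjective z (linForm a) 1 := by
  intro f hf hkill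
  refine mem_aotIdeal_of_coeff_eq_zero hf fun S hS => ?_
  obtain ⟨i, rfl⟩ := Finset.card_eq_one.mp hS
  have h2 : ∀ i j, i ≠ j →
      a i * coeff (squarefreeExp {j}) f + a j * coeff (squarefreeExp {i}) f = 0 := by
    intro i j hij
    have := hz.coeff_eq_zero hkill (T := {i, j}) (Finset.card_le_two.trans (by norm_num))
    rw [coeff_linForm_mul, Finset.sum_pair hij] at this
    have h1 : ({i, j} : Finset (Fin 5)).erase i = {j} := by ext s; simp; grind
    have h2 : ({i, j} : Finset (Fin 5)).erase j = {i} := by ext s; simp; grind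
    rwa [h1, h2] at this
  obtain ⟨j, k, hij, hik, hjk⟩ : ∃ j k : Fin 5, i ≠ j ∧ i ≠ k ∧ j ≠ k := by
    revert i; decide
  have : 2 * a j * a k * coeff (squarefreeExp {i}) f = 0 := by
    linear_combination a k * h2 i j hij + a j * h2 i k hik - a i * h2 j k hjk
  simpa [ha] using this

theorem IsFiveCycle.flatInjective_two [CharZero K] {z : Fin 5 → M} (hz : IsFiveCycle K z) {a : Fin 5 → K}
    (ha : ∀ i, a i ≠ 0) : FlatInjective z (linForm a) 2 := by
  intro f hf hkill
  refine mem_aotIdeal_of_coeff_eq_zero hf fun S hS => ?_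
  obtain ⟨i, j, hij, rfl⟩ := Finset.card_eq_two.mp hS
  have h3 : ∀ i j k, i ≠ j → i ≠ k → j ≠ k →
      a i * coeff (squarefreeExp {j, k}) f + a j * coeff (squarefreeExp {i, k}) f +
        a k * coeff (squarefreeExp {i, j}) f = 0 := by
    intro i j k hij hik hjk
    have := hz.coeff_eq_zero hkill (T := {i, j, k}) Finset.card_le_three
    rw [coeff_linForm_mul, Finset.sum_insert (by simp [hij, hik]), Finset.sum_pair hjk] at this
    have h1 : ({i, j, k} : Finset (Fin 5)).erase i = {j, k} := by ext s; simp; grind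
    have h2 : ({i, j, k} : Finset (Fin 5)).erase j = {i, k} := by ext s; simp; grind
    have h3 : ({i, j, k} : Finset (Fin 5)).erase k = {i, j} := by ext s; simp; grind
    rwa [h1, h2, h3, ← add_assoc] at this
  clear hS
  obtain ⟨k, hik, hjk⟩ : ∃ k : Fin 5, i ≠ k ∧ j ≠ k := by
    clear h3 hij; revert i j; decide
  obtain ⟨l, hil, hjl, hkl⟩ : ∃ l : Fin 5, i ≠ l ∧ j ≠ l ∧ k ≠ l := by
    clear h3 hij hik hjk; revert i j k; decide
  obtain ⟨m, him, hjm, hkm, hlm⟩ : ∃ m : Fin 5, i ≠ m ∧ j ≠ m ∧ k ≠ m ∧ l ≠ m := by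
    clear h3 hij hik hjk hil hjl hkl; revert i j k l; decide
  -- Inverse of the pair-triple inclusion matrix on five points, up to the factor 6: a triple has
  -- weight 2, -1 or 2 according to whether it meets `{i, j}` in 2, 1 or 0 points. The monomials in
  -- `a` rescale to the case where all `a` are 1.
  have : 6 * a k * a l * a m * coeff (squarefreeExp {i, j}) f = 0 := by
    linear_combination 2 * a l * a m * h3 i j k hij hik hjk + 2 * a k * a m * h3 i j l hij hil hjl
      + 2 * a k * a l * h3 i j m hij him hjm - a j * a m * h3 i k l hik hil hkl
      - a j * a l * h3 i k m hik him hkm - a j * a k * h3 i l m hil him hlm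
      - a i * a m * h3 j k l hjk hjl hkl - a i * a l * h3 j k m hjk hjm hkm
      - a i * a k * h3 j l m hjl hjm hlm + 2 * a i * a j * h3 k l m hkl hkm hlm
  simpa [ha] using this


theorem IsDigonTriangle.exists_dual {z : Fin 5 → M} (hz : IsDigonTriangle K z) (c₀ c₂ c₃ : K) :
    ∃ x : Module.Dual K M, x (z 0) = c₀ ∧ x (z 1) = -c₀ ∧ x (z 2) = c₂ ∧ x (z 3) = c₃ ∧
      x (z 4) = -c₂ - c₃ := by
  obtain ⟨x, h0, h2, h3⟩ := exists_dual_of_injective (p := z 0) (q := z 2) (r := z 3)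
    (fun b₀ b₁ b₂ h => by
      have := (hz ![b₀, 0, b₁, b₂, 0]).mp (by simpa [Fin.sum_univ_five] using h)
      simp at this
      grind) c₀ c₂ c₃
  obtain ⟨e1, e2⟩ := hz.add_eq_zero
  have e1' := congrArg x e1
  have e2' := congrArg x e2
  simp only [map_add, map_zero, h0, h2, h3] at e1' e2'
  refine ⟨x, h0, ?_, h2, h3, ?_⟩
  · linear_combination e1'
  · linear_combination e2'

theorem IsDigonTriangle.indep {z : Fin 5 → M} (hz : IsDigonTriangle K z) {T : Finset (Fin 5)}
    (h1 : 0 ∉ T ∨ 1 ∉ T) (h2 : 2 ∉ T ∨ 3 ∉ T ∨ 4 ∉ T) (b : Fin 5 → K)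
    (hb : ∀ i, i ∉ T → b i = 0) (hsum : ∑ i, b i • z i = 0) (i : Fin 5) : b i = 0 := by
  obtain ⟨e1, e2, e3⟩ := (hz b).mp hsum
  have h0 : b 0 = 0 := by
    rcases h1 with h | h
    · exact hb _ h
    · exact e1.trans (hb _ h)
  have h4 : b 4 = 0 := by
    rcases h2 with h | h | h
    · rw [← e3, ← e2, hb _ h]
    · rw [← e3, hb _ h]
    · exact hb _ h
  have h3 := e3.trans h4
  have h2' := e2.trans h3
  have h1' := e1.symm.trans h0
  fin_cases i
  exacts [h0, h1', h2', h3, h4]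

theorem IsDigonTriangle.finrank_span {z : Fin 5 → M} (hz : IsDigonTriangle K z)
    {T : Finset (Fin 5)} (h1 : 0 ∉ T ∨ 1 ∉ T) (h2 : 2 ∉ T ∨ 3 ∉ T ∨ 4 ∉ T) :
    Module.finrank K (Submodule.span K (z '' T)) = T.card := by
  refine finrank_span_image_of_indep fun b hb i hi => ?_
  have := hz.indep h1 h2 (fun i => if i ∈ T then b i else 0) (fun i hi => by simp [hi])
    (by simpa [ite_smul] using hb) i
  simpa [hi] using this

theorem IsDigonTriangle.notMem_span {z : Fin 5 → M} (hz : IsDigonTriangle K z)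
    {T : Finset (Fin 5)} {s : Fin 5} (hs : s ∉ T) (h1 : 0 ∉ insert s T ∨ 1 ∉ insert s T)
    (h2 : 2 ∉ insert s T ∨ 3 ∉ insert s T ∨ 4 ∉ insert s T) :
    z s ∉ Submodule.span K (z '' T) := by
  refine not_mem_span_image_of_indep hs fun b hbs hb hsum => ?_
  rw [hz.indep h1 h2 b hb hsum s] at hbs
  simp at hbs

theorem span_pair_eq_of_mem {p q p' q' : M} (h1 : p ∈ Submodule.span K {p', q'})
    (h2 : q ∈ Submodule.span K {p', q'}) (h3 : p' ∈ Submodule.span K {p, q})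
    (h4 : q' ∈ Submodule.span K {p, q}) :
    Submodule.span K {p, q} = Submodule.span K {p', q'} := by
  refine le_antisymm (Submodule.span_le.mpr ?_) (Submodule.span_le.mpr ?_)
  · rintro _ (rfl | rfl) <;> assumption
  · rintro _ (rfl | rfl) <;> assumption

/-- The flat spanned by `z 0` and `z k` is `{0, 1, k}`, with bases `{0, k}` and `{1, k}`. They are
weighted by `x (z 1)` and `x (z 0)`, which are opposite. -/
theorem IsDigonTriangle.coeff_pair_eq [CharZero K] {z : Fin 5 → M} (hz : IsDigonTriangle K z)
    {f : MvPolynomial (Fin 5) K} (hf : KilledByFlats z f) {k : Fin 5} (hk : 2 ≤ k) :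
    coeff (squarefreeExp {0, k}) f = coeff (squarefreeExp {1, k}) f := by
  obtain ⟨x, h0, h1, h2, h3, h4⟩ := hz.exists_dual 1 1 1
  have hx : ∀ s, x (z s) ≠ 0 := by
    intro s
    fin_cases s
    all_goals simp only [Fin.zero_eta, Fin.mk_one, Fin.reduceFinMk, h0, h1, h2, h3, h4]
    all_goals norm_num
  have hfin : Module.finrank K (Submodule.span K (z '' ({0, k} : Finset (Fin 5)))) = 2 := by
    rw [hz.finrank_span] <;> revert k <;> decide
  have hflat : ∀ s, z s ∈ Submodule.span K (z '' ({0, k} : Finset (Fin 5))) →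
      s ∈ ({0, 1, k} : Finset (Fin 5)) := by
    intro s
    contrapose
    intro hs
    apply hz.notMem_span <;> clear hfin hx <;> revert k s <;> decide
  have hdigon : Submodule.span K (z '' ({1, k} : Finset (Fin 5))) =
      Submodule.span K (z '' ({0, k} : Finset (Fin 5))) := by
    have hneg : z 1 = -z 0 := eq_neg_of_add_eq_zero_right hz.add_eq_zero.1
    simp only [Finset.coe_pair, Set.image_pair, hneg]
    apply span_pair_eq_of_mem <;> rw [Submodule.mem_span_pair]
    exacts [⟨-1, 0, by simp⟩, ⟨0, 1, by simp⟩, ⟨-1, 0, by simp⟩, ⟨0, 1, by simp⟩]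
  have hne : Submodule.span K (z '' ({0, 1} : Finset (Fin 5))) ≠
      Submodule.span K (z '' ({0, k} : Finset (Fin 5))) := by
    intro heq
    have hk' : z k ∈ Submodule.span K (z '' ({0, k} : Finset (Fin 5))) :=
      Submodule.subset_span ⟨k, by simp, rfl⟩
    have h10 : Submodule.span K (z '' ({0, 1} : Finset (Fin 5))) ≤
        Submodule.span K (z '' ({0} : Finset (Fin 5))) := by
      have hneg : z 1 = -z 0 := eq_neg_of_add_eq_zero_right hz.add_eq_zero.1
      rw [Submodule.span_le]
      simp [Set.insert_subset_iff, hneg, Submodule.mem_span_singleton_self]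
    rw [← heq] at hk'
    refine hz.notMem_span ?_ ?_ ?_ (h10 hk') <;> clear hfin hx heq hk' hflat hdigon h10 <;>
      revert k <;> decide
  have hpow : Finset.powersetCard 2 ({0, 1, k} : Finset (Fin 5)) = {{0, 1}, {0, k}, {1, k}} := by
    clear hfin hx hflat hdigon hne
    revert k; decide
  have h01 : ({0, k} : Finset (Fin 5)) ≠ {0, 1} := by
    clear hfin hx hflat hdigon hne hpow; revert k; decide
  have h02 : ({1, k} : Finset (Fin 5)) ≠ {0, 1} := by
    clear hfin hx hflat hdigon hne hpow; revert k; decide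
  have h03 : ({1, k} : Finset (Fin 5)) ≠ {0, k} := by
    clear hfin hx hflat hdigon hne hpow; revert k; decide
  have hd1 : ({0, 1, k} : Finset (Fin 5)) \ {0, k} = {1} := by
    clear hfin hx hflat hdigon hne hpow; revert k; decide
  have hd2 : ({0, 1, k} : Finset (Fin 5)) \ {1, k} = {0} := by
    clear hfin hx hflat hdigon hne hpow; revert k; decide
  have := hf.sum_powersetCard_eq_zero hflat (fun s _ => hx s) hfin
    (c := fun S => if S = {0, 1} then 0 else if S = {0, k} then -1 else 1) (by
      rw [hpow]
      intro S hS
      simp only [Finset.mem_insert, Finset.mem_singleton] at hS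
      rcases hS with rfl | rfl | rfl
      · right; exact ⟨hne, by simp⟩
      · left; exact ⟨rfl, by simp [h01, hd1, h1]⟩
      · left; exact ⟨hdigon, by simp [h02, h03, hd2, h0]⟩)
  rw [hpow, Finset.sum_insert (by simp [h01.symm, h02.symm]), Finset.sum_pair h03.symm] at this
  simp only [if_true, h01, h02, h03, if_false] at this
  linear_combination -this

/-- The functional of the triangle flat `{2, 3, 4}`: each pair is weighted by `x` of the remaining
edge. The point only has to avoid the digon, so `c₂` and `c₃` stay free. -/
theorem IsDigonTriangle.coeff_triangle [CharZero K] {z : Fin 5 → M} (hz : IsDigonTriangle K z)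
    {f : MvPolynomial (Fin 5) K} (hf : KilledByFlats z f) (c₂ c₃ : K) :
    (-c₂ - c₃) * coeff (squarefreeExp {2, 3}) f + c₃ * coeff (squarefreeExp {2, 4}) f +
      c₂ * coeff (squarefreeExp {3, 4}) f = 0 := by
  obtain ⟨x, h0, h1, h2, h3, h4⟩ := hz.exists_dual 1 c₂ c₃
  have hx : ∀ s ∉ ({2, 3, 4} : Finset (Fin 5)), x (z s) ≠ 0 := by
    intro s hs
    have : s = 0 ∨ s = 1 := by revert s; decide
    rcases this with rfl | rfl
    · simp [h0]
    · simp [h1]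
  have hfin : Module.finrank K (Submodule.span K (z '' ({2, 3} : Finset (Fin 5)))) = 2 := by
    rw [hz.finrank_span] <;> decide
  have hflat : ∀ s, z s ∈ Submodule.span K (z '' ({2, 3} : Finset (Fin 5))) →
      s ∈ ({2, 3, 4} : Finset (Fin 5)) := by
    intro s
    contrapose
    intro hs
    apply hz.notMem_span <;> clear hfin hx <;> revert s <;> decide
  have h4' : z 4 = -(z 2 + z 3) := eq_neg_of_add_eq_zero_right hz.add_eq_zero.2
  have hs1 : Submodule.span K (z '' ({2, 4} : Finset (Fin 5))) =
      Submodule.span K (z '' ({2, 3} : Finset (Fin 5))) := by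
    simp only [Finset.coe_pair, Set.image_pair, h4']
    apply span_pair_eq_of_mem <;> rw [Submodule.mem_span_pair]
    exacts [⟨1, 0, by simp⟩, ⟨-1, -1, by module⟩, ⟨1, 0, by simp⟩, ⟨-1, -1, by module⟩]
  have hs2 : Submodule.span K (z '' ({3, 4} : Finset (Fin 5))) =
      Submodule.span K (z '' ({2, 3} : Finset (Fin 5))) := by
    simp only [Finset.coe_pair, Set.image_pair, h4']
    apply span_pair_eq_of_mem <;> rw [Submodule.mem_span_pair]
    exacts [⟨0, 1, by simp⟩, ⟨-1, -1, by module⟩, ⟨-1, -1, by module⟩, ⟨1, 0, by simp⟩]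
  have hpow : Finset.powersetCard 2 ({2, 3, 4} : Finset (Fin 5)) = {{2, 3}, {2, 4}, {3, 4}} := by
    decide
  have n1 : ({2, 4} : Finset (Fin 5)) ≠ {2, 3} := by decide
  have n2 : ({3, 4} : Finset (Fin 5)) ≠ {2, 3} := by decide
  have n3 : ({3, 4} : Finset (Fin 5)) ≠ {2, 4} := by decide
  have d1 : ({2, 3, 4} : Finset (Fin 5)) \ {2, 3} = {4} := by decide
  have d2 : ({2, 3, 4} : Finset (Fin 5)) \ {2, 4} = {3} := by decide
  have d3 : ({2, 3, 4} : Finset (Fin 5)) \ {3, 4} = {2} := by decide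
  have := hf.sum_powersetCard_eq_zero hflat hx hfin
    (c := fun S => if S = {2, 3} then -c₂ - c₃ else if S = {2, 4} then c₃ else c₂) (by
      rw [hpow]
      intro S hS
      simp only [Finset.mem_insert, Finset.mem_singleton] at hS
      rcases hS with rfl | rfl | rfl
      · left; exact ⟨rfl, by rw [if_pos rfl, d1, Finset.prod_singleton, h4]⟩
      · left; exact ⟨hs1, by rw [if_neg n1, if_pos rfl, d2, Finset.prod_singleton, h3]⟩
      · left; exact ⟨hs2, by rw [if_neg n2, if_neg n3, d3, Finset.prod_singleton, h2]⟩)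
  rw [hpow, Finset.sum_insert (by simp [n1.symm, n2.symm]), Finset.sum_pair n3.symm] at this
  simp only [if_true, n1, n2, n3, if_false] at this
  linear_combination this

theorem IsDigonTriangle.X_add_X_mem {z : Fin 5 → M} (hz : IsDigonTriangle K z) :
    (X 0 + X 1 : MvPolynomial (Fin 5) K) ∈ aotIdeal K z := by
  have := relation_mem_aotIdeal (K := K) (ℓ := z) (Λ := {0, 1}) (c := 1)
    (by simpa using hz.add_eq_zero.1)
  have h0 : ({0, 1} : Finset (Fin 5)).erase 0 = {1} := by decide
  have h1 : ({0, 1} : Finset (Fin 5)).erase 1 = {0} := by decide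
  simpa [h0, h1, add_comm] using this

theorem IsDigonTriangle.flatInjective_zero [CharZero K] {z : Fin 5 → M} (hz : IsDigonTriangle K z)
    {a : Fin 5 → K} (ha : ∀ i, a i ≠ 0) : FlatInjective z (linForm a) 0 := by
  refine _root_.flatInjective_zero 2 (ha 2) fun s b hb hsum => ?_
  funext i
  refine hz.indep ?_ ?_ b hb hsum i <;> clear hb <;> revert s <;> decide

theorem IsDigonTriangle.flatInjective_one [CharZero K] {z : Fin 5 → M} (hz : IsDigonTriangle K z)
    {a : Fin 5 → K} (ha : ∀ i, a i ≠ 0) (ha' : ∀ i, a i ≠ a (i + 1)) :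
    FlatInjective z (linForm a) 1 := by
  intro f hf hkill
  set c : Fin 5 → K := fun i => coeff (squarefreeExp {i}) f with hc
  have h2 : ∀ i j, i ≠ j →
      coeff (squarefreeExp {i, j}) (linForm a * f) = a i * c j + a j * c i := by
    intro i j hij
    rw [coeff_linForm_mul, Finset.sum_pair hij]
    have h1 : ({i, j} : Finset (Fin 5)).erase i = {j} := by ext s; simp; grind
    have h2 : ({i, j} : Finset (Fin 5)).erase j = {i} := by ext s; simp; grind
    rw [h1, h2]
  have hα : a 0 - a 1 ≠ 0 := sub_ne_zero.mpr (ha' 0)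
  have e2 := hz.coeff_pair_eq hkill (k := 2) (by decide)
  have e3 := hz.coeff_pair_eq hkill (k := 3) (by decide)
  have e4 := hz.coeff_pair_eq hkill (k := 4) (by decide)
  have t1 := hz.coeff_triangle hkill 1 0
  have t2 := hz.coeff_triangle hkill 0 1
  rw [h2 _ _ (by decide), h2 _ _ (by decide)] at e2 e3 e4
  rw [h2 _ _ (by decide), h2 _ _ (by decide), h2 _ _ (by decide)] at t1 t2
  -- By `e2`, `e3`, `e4` each `c k` with k ≥ 2 is a common multiple of `a k`, the multiple being
  -- proportional to `c 0 - c 1`. The triangle condition `t2` then compares `a 2 * a 3` with `a 2 *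
  -- a 4`, and `a 3 ≠ a 4`.
  have hβ : c 0 - c 1 = 0 := by
    have : 2 * a 2 * (a 3 - a 4) * (c 0 - c 1) = 0 := by
      linear_combination (a 0 - a 1) * t2 + a 3 * e2 + a 2 * e3 - a 4 * e2 - a 2 * e4
    have h34 : a 3 ≠ a 4 := ha' 3
    simpa [ha, sub_eq_zero, h34] using this
  have hk : ∀ k, (a 0 * c k + a k * c 0 = a 1 * c k + a k * c 1) → c k = 0 := by
    intro k hk
    have : (a 0 - a 1) * c k = 0 := by linear_combination hk - a k * hβ
    exact (mul_eq_zero.mp this).resolve_left hα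
  -- What remains of `f` is a multiple of the digon relation.
  have hred : f - C (c 0) * (X 0 + X 1) ∈ aotIdeal K z := by
    refine mem_aotIdeal_of_coeff_eq_zero (n := 1)
      (hf.sub (((isHomogeneous_X _ _).add (isHomogeneous_X _ _)).C_mul _)) fun S hS => ?_
    obtain ⟨i, rfl⟩ := Finset.card_eq_one.mp hS
    have hX : ∀ j : Fin 5, coeff (squarefreeExp {i}) (X j : MvPolynomial (Fin 5) K) =
        if j = i then 1 else 0 := by
      intro j
      simp [squarefreeExp, coeff_X, Finsupp.single_left_inj]
    rw [coeff_sub, coeff_C_mul, coeff_add, hX, hX]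
    change c i - _ = 0
    fin_cases i
    · simp
    · simp [← sub_eq_zero.mp hβ]
    · simpa using hk 2 e2
    · simpa using hk 3 e3
    · simpa using hk 4 e4
  have := Ideal.add_mem _ hred (Ideal.mul_mem_left _ (C (c 0)) hz.X_add_X_mem)
  simpa using this

theorem IsTripleTriangle.flatInjective_zero [CharZero K] {z : Fin 5 → M} (hz : IsTripleTriangle K z)
    {a : Fin 5 → K} (ha : ∀ i, a i ≠ 0) : FlatInjective z (linForm a) 0 := by
  refine _root_.flatInjective_zero 3 (ha 3) fun s b hb hsum => ?_
  obtain ⟨e1, e2⟩ := (hz b).mp hsum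
  have h0 := hb 0
  have h1 := hb 1
  have h2 := hb 2
  have h4 := hb 4
  funext i
  simp only [Finset.mem_insert, Finset.mem_singleton] at h0 h1 h2 h4
  have : b 0 = 0 ∧ b 1 = 0 ∧ b 2 = 0 ∧ b 3 = 0 ∧ b 4 = 0 := by
    fin_cases s <;> simp at h0 h1 h2 h4 <;> simp_all
  fin_cases i
  exacts [this.1, this.2.1, this.2.2.1, this.2.2.2.1, this.2.2.2.2]

end FiveCycleInjective

/-! ### Vanishing of the cokernel for the contracted five-cycles. -/

section FiveCycleCokernel

variable {K : Type*} [Field K] {M : Type*} [AddCommGroup M] [Module K M]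

theorem isUnit_mk_C {ι : Type*} (J : Ideal (MvPolynomial ι K)) {c : K} (hc : c ≠ 0) :
    IsUnit (Ideal.Quotient.mk J (C c)) :=
  (hc.isUnit.map C).map _

theorem mk_X_sq {z : Fin 5 → M} (a : Fin 5 → K) (i : Fin 5) :
    Ideal.Quotient.mk (aotIdeal K z ⊔ Ideal.span {linForm a}) (X i) ^ 2 = 0 := by
  rw [← map_pow, Ideal.Quotient.eq_zero_iff_mem]
  exact Ideal.mem_sup_left (X_sq_mem_aotIdeal z i)

theorem mk_linForm (z : Fin 5 → M) (a : Fin 5 → K) :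
    ∑ i, Ideal.Quotient.mk (aotIdeal K z ⊔ Ideal.span {linForm a}) (C (a i)) *
      Ideal.Quotient.mk (aotIdeal K z ⊔ Ideal.span {linForm a}) (X i) = 0 := by
  simp only [← map_mul, ← map_sum]
  rw [Ideal.Quotient.eq_zero_iff_mem]
  exact Ideal.mem_sup_right (Ideal.subset_span rfl)

theorem cokernelVanishes_of_prod_eq_zero {z : Fin 5 → M} {a : Fin 5 → K} {n : ℕ}
    (h : ∀ S : Finset (Fin 5), S.card = n → ∏ s ∈ S,
      Ideal.Quotient.mk (aotIdeal K z ⊔ Ideal.span {linForm a}) (X s) = 0) :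
    CokernelVanishes z (linForm a) n := by
  intro g hg
  refine mem_of_squarefree_coeff_mem (fun i => Ideal.mem_sup_left (X_sq_mem_aotIdeal z i)) hg
    fun S hS => Ideal.mul_mem_left _ _ ?_
  rw [← Ideal.Quotient.eq_zero_iff_mem, map_prod]
  exact h S hS

/-- The squares alone suffice. Modulo L, A_m y_m is minus the sum of the other four terms, so the
square of that sum is zero; multiplying by y_i y_j leaves only 2 A_k A_l y_i y_j y_k y_l. -/
theorem cokernelVanishes_four [CharZero K] (z : Fin 5 → M) {a : Fin 5 → K} (ha : ∀ i, a i ≠ 0) :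
    CokernelVanishes z (linForm a) 4 := by
  refine cokernelVanishes_of_prod_eq_zero fun S hS => ?_
  have hL := mk_linForm z a
  have hsq := mk_X_sq (z := z) a
  set J := aotIdeal K z ⊔ Ideal.span {linForm a}
  generalize hy : (fun i => Ideal.Quotient.mk J (X i)) = y at *
  have hy' : ∀ i, Ideal.Quotient.mk J (X i) = y i := congrFun hy
  simp only [hy'] at *
  set A : Fin 5 → MvPolynomial (Fin 5) K ⧸ J := fun i => Ideal.Quotient.mk J (C (a i)) with hA
  have hu : ∀ k l, IsUnit (2 * A k * A l) := by
    intro k l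
    have h2 := isUnit_mk_C J (c := 1 + 1) (by norm_num)
    rw [map_add, map_add, map_one, map_one, one_add_one_eq_two] at h2
    exact (h2.mul (isUnit_mk_C J (ha k))).mul (isUnit_mk_C J (ha l))
  have key : ∀ i j k l m, A i * y i + A j * y j + A k * y k + A l * y l + A m * y m = 0 →
      y i * y j * y k * y l = 0 := by
    intro i j k l m h
    rw [← (hu k l).mul_right_eq_zero]
    linear_combination
      (A i * y i + A j * y j + A k * y k + A l * y l - A m * y m) * y i * y j * h
      + A m ^ 2 * y i * y j * hsq m - A k ^ 2 * y i * y j * hsq k - A l ^ 2 * y i * y j * hsq l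
      - (A i ^ 2 * y i * y j + 2 * A i * A j * y j ^ 2 + 2 * A i * A k * y k * y j
        + 2 * A i * A l * y l * y j) * hsq i
      - (A j ^ 2 * y i * y j + 2 * A j * A k * y k * y i + 2 * A j * A l * y l * y i) * hsq j
  have hS' : S = {0, 1, 2, 3} ∨ S = {0, 1, 2, 4} ∨ S = {0, 1, 3, 4} ∨ S = {0, 2, 3, 4} ∨
      S = {1, 2, 3, 4} := by
    clear key hu; revert S; decide
  rw [Fin.sum_univ_five] at hL
  rcases hS' with rfl | rfl | rfl | rfl | rfl
  · have := key 0 1 2 3 4 (by linear_combination hL)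
    simpa [Finset.prod_insert, mul_assoc] using this
  · have := key 0 1 2 4 3 (by linear_combination hL)
    simpa [Finset.prod_insert, mul_assoc] using this
  · have := key 0 1 3 4 2 (by linear_combination hL)
    simpa [Finset.prod_insert, mul_assoc] using this
  · have := key 0 2 3 4 1 (by linear_combination hL)
    simpa [Finset.prod_insert, mul_assoc] using this
  · have := key 1 2 3 4 0 (by linear_combination hL)
    simpa [Finset.prod_insert, mul_assoc] using this

theorem triangle_relation_mem {ι : Type*} [DecidableEq ι] {ℓ : ι → M} {i j k : ι} (hij : i ≠ j)
    (hik : i ≠ k) (hjk : j ≠ k) (h : ℓ i + ℓ j + ℓ k = 0) :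
    (X i * X j + X j * X k + X i * X k : MvPolynomial ι K) ∈ aotIdeal K ℓ := by
  have := relation_mem_aotIdeal (K := K) (ℓ := ℓ) (Λ := {i, j, k}) (c := 1)
    (by simpa [Finset.sum_insert, hij, hik, hjk, add_assoc] using h)
  have h1 : ({i, j, k} : Finset ι).erase i = {j, k} := by ext s; simp; grind
  have h2 : ({i, j, k} : Finset ι).erase j = {i, k} := by ext s; simp; grind
  have h3 : ({i, j, k} : Finset ι).erase k = {i, j} := by ext s; simp; grind
  rw [Finset.sum_insert (by simp [hij, hik]), Finset.sum_pair hjk, h1, h2, h3,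
    Finset.prod_pair hjk, Finset.prod_pair hij, Finset.prod_pair hik] at this
  convert this using 1
  simp only [Pi.one_apply, map_one]
  ring

theorem pair_relation_mem {ι : Type*} [DecidableEq ι] {ℓ : ι → M} {i j : ι} (hij : i ≠ j)
    (h : ℓ i + ℓ j = 0) : (X i + X j : MvPolynomial ι K) ∈ aotIdeal K ℓ := by
  have := relation_mem_aotIdeal (K := K) (ℓ := ℓ) (Λ := {i, j}) (c := 1)
    (by simpa [Finset.sum_pair hij] using h)
  have h1 : ({i, j} : Finset ι).erase i = {j} := by ext s; simp; grind
  have h2 : ({i, j} : Finset ι).erase j = {i} := by ext s; simp; grind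
  rw [Finset.sum_pair hij, h1, h2, Finset.prod_singleton, Finset.prod_singleton] at this
  convert this using 1
  simp only [Pi.one_apply, map_one]
  ring

/-- The digon gives y₁ = -y₀, hence y₀y₁ = 0, and the triangle relation times y₄ gives y₂y₃y₄ = 0.
For j, k in the triangle, y_j y_k L then reduces to (A₀ - A₁) y₀ y_j y_k, with a unit in front. -/
theorem IsDigonTriangle.cokernelVanishes_three {z : Fin 5 → M} (hz : IsDigonTriangle K z)
    {a : Fin 5 → K} (ha' : ∀ i, a i ≠ a (i + 1)) : CokernelVanishes z (linForm a) 3 := by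
  refine cokernelVanishes_of_prod_eq_zero fun S hS => ?_
  have hL := mk_linForm z a
  have hsq := mk_X_sq (z := z) a
  have h01 := pair_relation_mem (K := K) (by decide) hz.add_eq_zero.1
  have h234 := triangle_relation_mem (K := K) (by decide) (by decide) (by decide) hz.add_eq_zero.2
  set J := aotIdeal K z ⊔ Ideal.span {linForm a} with hJ
  have h01' := Ideal.Quotient.eq_zero_iff_mem.mpr
    (Ideal.mem_sup_left (T := Ideal.span {linForm a}) h01)
  have h234' := Ideal.Quotient.eq_zero_iff_mem.mpr
    (Ideal.mem_sup_left (T := Ideal.span {linForm a}) h234)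
  rw [← hJ] at h01' h234'
  simp only [map_add, map_mul] at h01' h234'
  clear h01 h234
  generalize hy : (fun i => Ideal.Quotient.mk J (X i)) = y at *
  have hy' : ∀ i, Ideal.Quotient.mk J (X i) = y i := congrFun hy
  simp only [hy'] at *
  set A : Fin 5 → MvPolynomial (Fin 5) K ⧸ J := fun i => Ideal.Quotient.mk J (C (a i)) with hA
  have hu : IsUnit (A 0 - A 1) := by
    have : A 0 - A 1 = Ideal.Quotient.mk J (C (a 0 - a 1)) := by simp [hA]
    rw [this]
    exact isUnit_mk_C J (sub_ne_zero.mpr (ha' 0))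
  rw [Fin.sum_univ_five] at hL
  have p01 : y 0 * y 1 = 0 := by linear_combination y 0 * h01' - hsq 0
  have p234 : y 2 * y 3 * y 4 = 0 := by
    linear_combination y 4 * h234' - (y 2 + y 3) * hsq 4
  have q : ∀ j k l, A 2 * y 2 + A 3 * y 3 + A 4 * y 4 = A j * y j + A k * y k + A l * y l →
      y j * y k * y l = 0 → y 0 * (y j * y k) = 0 := by
    intro j k l h h'
    rw [← hu.mul_right_eq_zero]
    linear_combination y j * y k * hL - A 1 * y j * y k * h01' - y j * y k * h - A l * h'
      - A j * y k * hsq j - A k * y j * hsq k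
  have q23 := q 2 3 4 rfl p234
  have q24 := q 2 4 3 (by ring) (by linear_combination p234)
  have q34 := q 3 4 2 (by ring) (by linear_combination p234)
  have r : ∀ t, y 0 * t = 0 → y 1 * t = 0 := fun t ht => by linear_combination t * h01' - ht
  have hS' : S = {0, 1, 2} ∨ S = {0, 1, 3} ∨ S = {0, 1, 4} ∨ S = {0, 2, 3} ∨ S = {0, 2, 4} ∨
      S = {0, 3, 4} ∨ S = {1, 2, 3} ∨ S = {1, 2, 4} ∨ S = {1, 3, 4} ∨ S = {2, 3, 4} := by
    clear q r; revert S; decide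
  have P : ∀ i j k : Fin 5, i ≠ j → i ≠ k → j ≠ k →
      ∏ s ∈ ({i, j, k} : Finset (Fin 5)), y s = y i * (y j * y k) := by
    intro i j k hij hik hjk
    rw [Finset.prod_insert (by simp [hij, hik]), Finset.prod_pair hjk]
  rcases hS' with rfl | rfl | rfl | rfl | rfl | rfl | rfl | rfl | rfl | rfl <;>
    rw [P _ _ _ (by decide) (by decide) (by decide)]
  · linear_combination y 2 * p01
  · linear_combination y 3 * p01
  · linear_combination y 4 * p01
  · exact q23
  · exact q24
  · exact q34
  · exact r _ q23
  · exact r _ q24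
  · exact r _ q34
  · linear_combination p234

theorem IsTripleTriangle.add_eq_zero {z : Fin 5 → M} (hz : IsTripleTriangle K z) :
    z 0 + z 1 = 0 ∧ z 1 + z 2 = 0 ∧ z 0 + z 3 + z 4 = 0 := by
  have h1 := (hz ![1, 1, 0, 0, 0]).mpr (by simp)
  have h2 := (hz ![0, 1, 1, 0, 0]).mpr (by simp)
  have h3 := (hz ![1, 0, 0, 1, 1]).mpr (by simp)
  simp [Fin.sum_univ_five] at h1 h2 h3
  exact ⟨h1, h2, h3⟩

/-- The parallel edges give y₁ = -y₀ and y₂ = y₀, leaving the triangle on y₀, y₃, y₄ and a linear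
form whose coefficient at y₀ is α = A₀ - A₁ + A₂. Nothing prevents α from being zero. -/
theorem IsTripleTriangle.cokernelVanishes_two [CharZero K] {z : Fin 5 → M}
    (hz : IsTripleTriangle K z) {a : Fin 5 → K} (ha : ∀ i, a i ≠ 0)
    (ha' : ∀ i, a i ≠ a (i + 1)) : CokernelVanishes z (linForm a) 2 := by
  refine cokernelVanishes_of_prod_eq_zero fun S hS => ?_
  have hL := mk_linForm z a
  have hsq := mk_X_sq (z := z) a
  have h01 := pair_relation_mem (K := K) (by decide) hz.add_eq_zero.1
  have h12 := pair_relation_mem (K := K) (by decide) hz.add_eq_zero.2.1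
  have h034 := triangle_relation_mem (K := K) (by decide) (by decide) (by decide)
    hz.add_eq_zero.2.2
  set J := aotIdeal K z ⊔ Ideal.span {linForm a} with hJ
  have h01' := Ideal.Quotient.eq_zero_iff_mem.mpr
    (Ideal.mem_sup_left (T := Ideal.span {linForm a}) h01)
  have h12' := Ideal.Quotient.eq_zero_iff_mem.mpr
    (Ideal.mem_sup_left (T := Ideal.span {linForm a}) h12)
  have h034' := Ideal.Quotient.eq_zero_iff_mem.mpr
    (Ideal.mem_sup_left (T := Ideal.span {linForm a}) h034)
  rw [← hJ] at h01' h12' h034'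
  simp only [map_add, map_mul] at h01' h12' h034'
  clear h01 h12 h034
  generalize hy : (fun i => Ideal.Quotient.mk J (X i)) = y at *
  have hy' : ∀ i, Ideal.Quotient.mk J (X i) = y i := congrFun hy
  simp only [hy'] at *
  set A : Fin 5 → MvPolynomial (Fin 5) K ⧸ J := fun i => Ideal.Quotient.mk J (C (a i)) with hA
  rw [Fin.sum_univ_five] at hL
  have hu : ∀ i, IsUnit (A i) := fun i => isUnit_mk_C J (ha i)
  have hL' : (A 0 - A 1 + A 2) * y 0 + A 3 * y 3 + A 4 * y 4 = 0 := by
    linear_combination hL - (A 1 - A 2) * h01' - A 2 * h12'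
  have p : y 0 * y 3 = 0 ∧ y 0 * y 4 = 0 := by
    -- Multiplying L by y₀ + y₃ and using the triangle relation gives (α + A₃ - A₄) y₀y₃ = 0; using
    -- y₀ + y₄ gives (α + A₄ - A₃) y₀y₄ = 0. Both scalars cannot vanish since `a 3 ≠ a 4`, and y₀ L
    -- = 0 then yields the other product.
    by_cases hcase : a 0 - a 1 + a 2 + a 3 - a 4 = 0
    · have hne : a 4 + (a 0 - a 1 + a 2) - a 3 ≠ 0 := by
        intro h
        have : 2 * (a 3 - a 4) = 0 := by linear_combination hcase - h
        have h34 : a 3 ≠ a 4 := ha' 3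
        simp [sub_eq_zero, h34] at this
      have hun : IsUnit (A 4 + (A 0 - A 1 + A 2) - A 3) := by
        have : A 4 + (A 0 - A 1 + A 2) - A 3 =
          Ideal.Quotient.mk J (C (a 4 + (a 0 - a 1 + a 2) - a 3)) := by simp [hA]
        rw [this]
        exact isUnit_mk_C J hne
      have h1 : y 0 * y 4 = 0 := by
        rw [← hun.mul_right_eq_zero]
        linear_combination (y 0 + y 4) * hL' - A 3 * h034' - (A 0 - A 1 + A 2) * hsq 0
          - A 4 * hsq 4
      refine ⟨?_, h1⟩
      rw [← (hu 3).mul_right_eq_zero]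
      linear_combination y 0 * hL' - (A 0 - A 1 + A 2) * hsq 0 - A 4 * h1
    · have hun : IsUnit (A 0 - A 1 + A 2 + A 3 - A 4) := by
        have : A 0 - A 1 + A 2 + A 3 - A 4 =
          Ideal.Quotient.mk J (C (a 0 - a 1 + a 2 + a 3 - a 4)) := by simp [hA]
        rw [this]
        exact isUnit_mk_C J hcase
      have h1 : y 0 * y 3 = 0 := by
        rw [← hun.mul_right_eq_zero]
        linear_combination (y 0 + y 3) * hL' - A 4 * h034' - (A 0 - A 1 + A 2) * hsq 0
          - A 3 * hsq 3
      refine ⟨h1, ?_⟩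
      rw [← (hu 4).mul_right_eq_zero]
      linear_combination y 0 * hL' - (A 0 - A 1 + A 2) * hsq 0 - A 3 * h1
  obtain ⟨p03, p04⟩ := p
  have p34 : y 3 * y 4 = 0 := by linear_combination h034' - p03 - p04
  have r : ∀ t, y 0 * t = 0 → y 1 * t = 0 := fun t ht => by linear_combination t * h01' - ht
  have r' : ∀ t, y 0 * t = 0 → y 2 * t = 0 := fun t ht => by
    linear_combination t * h12' - r t ht
  have p00 : y 0 * y 0 = 0 := by linear_combination hsq 0
  have p01 : y 0 * y 1 = 0 := by linear_combination r _ p00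
  have p02 : y 0 * y 2 = 0 := by linear_combination r' _ p00
  have hS' : S = {0, 1} ∨ S = {0, 2} ∨ S = {0, 3} ∨ S = {0, 4} ∨ S = {1, 2} ∨ S = {1, 3} ∨
      S = {1, 4} ∨ S = {2, 3} ∨ S = {2, 4} ∨ S = {3, 4} := by
    clear r r'; revert S; decide
  rcases hS' with rfl | rfl | rfl | rfl | rfl | rfl | rfl | rfl | rfl | rfl <;>
    rw [Finset.prod_pair (by decide)]
  exacts [p01, p02, p03, p04, r _ p02, r _ p03, r _ p04, r' _ p03, r' _ p04, p34]

end FiveCycleCokernel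

/-! ### Relations after contraction, and the induction over chords. -/

section ChordInduction

variable {K : Type*} [Field K]

/-- The relation `z_i + z_{i+1} = 0`, as a vector of coefficients. -/
def chordVec (K : Type*) [Field K] (i : Fin 5) : Fin 5 → K := Pi.single i 1 + Pi.single (i + 1) 1

/-- The relations between the five vectors are generated by `∑ z_i = 0` and `z_i + z_{i+1} = 0`,
`i ∈ C`: they are the edge vectors of a five-cycle after contraction of the chords in `C`. -/
def HasRelations {M : Type*} [AddCommGroup M] [Module K M] (z : Fin 5 → M)
    (C : Finset (Fin 5)) : Prop :=
  ∀ b : Fin 5 → K, ∑ i, b i • z i = 0 ↔ b ∈ Submodule.span K (insert 1 (chordVec K '' C))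

variable {M : Type*} [AddCommGroup M] [Module K M]

theorem sum_chordVec_smul (z : Fin 5 → M) (i : Fin 5) :
    ∑ j, chordVec K i j • z j = z i + z (i + 1) := by
  simp [chordVec, add_smul, Finset.sum_add_distrib, Pi.single_apply, ite_smul]

theorem HasRelations.chord_eq_zero {z : Fin 5 → M} {C : Finset (Fin 5)}
    (h : HasRelations (K := K) z C) {i : Fin 5} (hi : i ∈ C) : z i + z (i + 1) = 0 := by
  rw [← sum_chordVec_smul (K := K)]
  exact (h _).mpr (Submodule.subset_span (Or.inr ⟨i, hi, rfl⟩))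

theorem HasRelations.sum_eq_zero {z : Fin 5 → M} {C : Finset (Fin 5)}
    (h : HasRelations (K := K) z C) : ∑ i, z i = 0 := by
  simpa using (h 1).mpr (Submodule.subset_span (Or.inl rfl))

theorem sum_rotate {A : Type*} [AddCommMonoid A] (g : Fin 5 → A) (i : Fin 5) :
    ∑ j, g (i + j) = ∑ j, g j :=
  Equiv.sum_comp (Equiv.addLeft i) g

theorem sum_smul_rotate (z : Fin 5 → M) (b : Fin 5 → K) (i : Fin 5) :
    ∑ j, b j • z (i + j) = ∑ j, b (j - i) • z j := by
  rw [← sum_rotate (fun j => b (j - i) • z j) i]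
  simp

theorem HasRelations.isFiveCycle {z : Fin 5 → M} (h : HasRelations (K := K) z ∅) :
    IsFiveCycle K z := by
  intro b
  rw [h b]
  simp only [Finset.coe_empty, Set.image_empty, insert_empty_eq, Submodule.mem_span_singleton]
  constructor
  · rintro ⟨t, rfl⟩ i
    simp
  · intro hb
    exact ⟨b 0, by ext i; simp [hb i]⟩

theorem HasRelations.isDigonTriangle {z : Fin 5 → M} {i : Fin 5}
    (h : HasRelations (K := K) z {i}) : IsDigonTriangle K (fun j => z (i + j)) := by
  intro b
  rw [sum_smul_rotate, h]
  simp only [Finset.coe_singleton, Set.image_singleton, Submodule.mem_span_pair]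
  constructor
  · rintro ⟨t, s, hb⟩
    have hb' : ∀ j, b j = t + s * chordVec K i (i + j) := fun j => by
      simpa using (congrFun hb (i + j)).symm
    simp only [hb', chordVec, Pi.add_apply, Pi.single_apply, add_right_inj, add_eq_left]
    simp
  · rintro ⟨h1, h2, h3⟩
    refine ⟨b 4, b 0 - b 4, ?_⟩
    ext j
    obtain ⟨k, rfl⟩ : ∃ k, j = i + k := ⟨j - i, by simp⟩
    simp only [chordVec, Pi.add_apply, Pi.smul_apply, Pi.single_apply, add_right_inj, add_eq_left,
      add_sub_cancel_left]
    fin_cases k <;> simp [h1, h2, h3]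

theorem HasRelations.isTripleTriangle {z : Fin 5 → M} {i : Fin 5}
    (h : HasRelations (K := K) z {i, i + 1}) : IsTripleTriangle K (fun j => z (i + j)) := by
  intro b
  rw [sum_smul_rotate, h]
  simp only [Finset.coe_pair, Set.image_pair, Submodule.mem_span_triple]
  constructor
  · rintro ⟨t, s, r, hb⟩
    have hb' : ∀ j, b j = t + s * chordVec K i (i + j) + r * chordVec K (i + 1) (i + j) :=
      fun j => by simpa using (congrFun hb (i + j)).symm
    simp only [hb', chordVec, Pi.add_apply, Pi.single_apply, add_right_inj, add_eq_left, add_assoc]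
    simp
    ring
  · rintro ⟨h1, h2⟩
    refine ⟨b 4, b 0 - b 4, b 2 - b 4, ?_⟩
    ext j
    obtain ⟨k, rfl⟩ : ∃ k, j = i + k := ⟨j - i, by simp⟩
    simp only [chordVec, Pi.add_apply, Pi.smul_apply, Pi.single_apply, add_right_inj, add_eq_left,
      add_sub_cancel_left, add_assoc]
    fin_cases k <;> simp [h1]
    linear_combination h2 + h1

theorem rename_addLeft_linForm (a : Fin 5 → K) (i : Fin 5) :
    rename (Equiv.addLeft i) (linForm fun j => a (i + j)) = linForm a := by
  rw [linForm, linForm, map_sum, ← sum_rotate (fun j => C (a j) * X j) i]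
  simp

theorem FlatInjective.of_eq_top {ι : Type*} [Fintype ι] [DecidableEq ι] {ℓ : ι → M}
    (h : aotIdeal K ℓ = ⊤) (L : MvPolynomial ι K) (n : ℕ) : FlatInjective ℓ L n :=
  fun f _ _ => by rw [h]; trivial

theorem CokernelVanishes.of_eq_top {ι : Type*} [DecidableEq ι] {ℓ : ι → M}
    (h : aotIdeal K ℓ = ⊤) (L : MvPolynomial ι K) (n : ℕ) : CokernelVanishes ℓ L n :=
  fun f _ => by rw [h, top_sup_eq]; trivial

theorem contractedCycle_maximal_rank [CharZero K] {a : Fin 5 → K} (ha : ∀ i, a i ≠ 0)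
    (ha' : ∀ i, a i ≠ a (i + 1)) {z : Fin 5 → M} {C : Finset (Fin 5)}
    (h : HasRelations (K := K) z C) :
    (∀ d, d + C.card ≤ 2 → FlatInjective z (linForm a) d) ∧
      ∀ d, d + C.card = 4 → CokernelVanishes z (linForm a) d := by
  -- Chords `i` and `i + 2` cover four cycle edges, so contracting both turns the fifth, `i + 4`,
  -- into a loop. A subset of ℤ/5 with no two elements at distance 2 is empty, a singleton or a pair
  -- of neighbours.
  have hC : (∃ i, i ∈ C ∧ i + 2 ∈ C) ∨ C = ∅ ∨ (∃ i, C = {i}) ∨ ∃ i, C = {i, i + 1} := by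
    clear h; revert C; decide
  rcases hC with ⟨i, h1, h2⟩ | rfl | ⟨i, rfl⟩ | ⟨i, rfl⟩
  · have e1 := h.chord_eq_zero h1
    have e2 := h.chord_eq_zero h2
    have e3 := h.sum_eq_zero
    rw [← sum_rotate _ i, Fin.sum_univ_five] at e3
    have h4 : z (i + 4) = 0 := by
      rw [add_zero, e1, zero_add, show i + 3 = i + 2 + 1 by rw [add_assoc]; rfl, e2, zero_add] at e3
      exact e3
    have htop := aotIdeal_eq_top (K := K) h4
    exact ⟨fun d _ => .of_eq_top htop _ _, fun d _ => .of_eq_top htop _ _⟩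
  · have hz := h.isFiveCycle
    refine ⟨fun d hd => ?_, fun d hd => ?_⟩
    · obtain rfl | rfl | rfl : d = 0 ∨ d = 1 ∨ d = 2 := by simp at hd; omega
      · refine flatInjective_zero 0 (ha 0) fun s b hb hsum => ?_
        have hbc := (hz b).mp hsum
        obtain ⟨i, hi⟩ : ∃ i, i ∉ insert s ({0} : Finset (Fin 5)) := by
          clear hb; revert s; decide
        funext t
        rw [hbc t, ← hbc i, hb i hi]; rfl
      · exact hz.flatInjective_one ha
      · exact hz.flatInjective_two ha
    · obtain rfl : d = 4 := by simpa using hd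
      exact cokernelVanishes_four z ha
  · have hz := h.isDigonTriangle
    rw [← rename_addLeft_linForm a i]
    refine ⟨fun d hd => ?_, fun d hd => ?_⟩
    · refine FlatInjective.of_equiv (ℓ := z) (Equiv.addLeft i) ?_
      obtain rfl | rfl : d = 0 ∨ d = 1 := by simp at hd; omega
      · exact hz.flatInjective_zero fun j => ha _
      · exact hz.flatInjective_one (fun j => ha _) fun j => by rw [← add_assoc]; exact ha' _
    · refine CokernelVanishes.of_equiv (ℓ := z) (Equiv.addLeft i) ?_
      obtain rfl : d = 3 := by simp at hd; omega
      exact hz.cokernelVanishes_three fun j => by rw [← add_assoc]; exact ha' _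
  · have hz := h.isTripleTriangle
    have hcard : ({i, i + 1} : Finset (Fin 5)).card = 2 := Finset.card_pair (by simp)
    rw [← rename_addLeft_linForm a i, hcard]
    refine ⟨fun d hd => ?_, fun d hd => ?_⟩
    · refine FlatInjective.of_equiv (ℓ := z) (Equiv.addLeft i) ?_
      obtain rfl : d = 0 := by omega
      exact hz.flatInjective_zero fun j => ha _
    · refine CokernelVanishes.of_equiv (ℓ := z) (Equiv.addLeft i) ?_
      obtain rfl : d = 2 := by omega
      exact hz.cokernelVanishes_two (fun j => ha _) fun j => by rw [← add_assoc]; exact ha' _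

/-- A combination vanishes modulo `e` exactly when it equals a multiple of `e`, that is, when
correcting it by a multiple of `chordVec K k` makes it a relation. -/
theorem HasRelations.contract {z : Fin 5 → M} {C : Finset (Fin 5)}
    (h : HasRelations (K := K) z C) {k : Fin 5} {c : K} (hc : c ≠ 0) {e : M}
    (he : e = c • (z k + z (k + 1))) : HasRelations (K := K)
      (fun i => (Submodule.Quotient.mk (z i) : M ⧸ Submodule.span K {e})) (insert k C) := by
  intro b
  have h1 : ∑ i, b i • (Submodule.Quotient.mk (z i) : M ⧸ Submodule.span K {e}) =
      Submodule.Quotient.mk (∑ i, b i • z i) := by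
    rw [← Submodule.mkQ_apply, map_sum]
    simp
  rw [h1, Submodule.Quotient.mk_eq_zero, Submodule.mem_span_singleton, Finset.coe_insert,
    Set.image_insert_eq, Set.insert_comm, Submodule.mem_span_insert']
  have h2 : ∀ r : K, b + r • chordVec K k ∈ Submodule.span K (insert 1 (chordVec K '' C)) ↔
      ∑ i, b i • z i + r • (z k + z (k + 1)) = 0 := by
    intro r
    rw [← h, ← sum_chordVec_smul (K := K), Finset.smul_sum, ← Finset.sum_add_distrib]
    simp [add_smul, smul_smul]
  simp only [h2]
  constructor
  · rintro ⟨r, hr⟩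
    refine ⟨-(r * c), ?_⟩
    rw [← hr, he]
    module
  · rintro ⟨r, hr⟩
    refine ⟨-(r * c⁻¹), ?_⟩
    rw [eq_neg_of_add_eq_zero_left hr, he, smul_smul, neg_mul, mul_assoc, inv_mul_cancel₀ hc,
      mul_one, neg_smul]

/-- Maximal rank in all the relevant degrees, for a family obtained from a five-cycle by adding
chords and contracting the chords in `C`. -/
theorem maximal_rank_of_chords.{u, v} {K : Type*} [Field K] [CharZero K] {a : Fin 5 → K}
    (ha : ∀ i, a i ≠ 0) (ha' : ∀ i, a i ≠ a (i + 1)) (n : ℕ) :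
    ∀ {ι : Type u} [Fintype ι] [DecidableEq ι] {M : Type v} [AddCommGroup M] [Module K M]
      [FiniteDimensional K M] (ℓ : ι → M) (j : Fin 5 → ι) (C : Finset (Fin 5)),
      Fintype.card ι = n → Function.Injective j → HasRelations (K := K) (fun i => ℓ (j i)) C →
      (∀ s, s ∉ Set.range j → ∃ i, ∃ c : K, ℓ s = c • (ℓ (j i) + ℓ (j (i + 1)))) →
      (∀ d, d + C.card ≤ 2 → FlatInjective ℓ (rename j (linForm a)) d) ∧
        ∀ d, d + C.card = 4 → CokernelVanishes ℓ (rename j (linForm a)) d := by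
  induction n with
  | zero =>
    intro ι _ _ M _ _ _ ℓ j C hcard
    exact ((Fintype.card_eq_zero_iff.mp hcard).false (j 0)).elim
  | succ n ih =>
    intro ι _ _ M _ _ _ ℓ j C hcard hj hC hch
    by_cases hsurj : Function.Surjective j
    · have := contractedCycle_maximal_rank ha ha' hC
      let σ : Fin 5 ≃ ι := Equiv.ofBijective j ⟨hj, hsurj⟩
      exact ⟨fun d hd => (this.1 d hd).of_equiv (ℓ := ℓ) σ,
        fun d hd => (this.2 d hd).of_equiv (ℓ := ℓ) σ⟩
    · obtain ⟨e, he⟩ : ∃ e, e ∉ Set.range j := by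
        by_contra! hall
        exact hsurj hall
      -- A chord may have become a loop through earlier contractions; then the algebra is zero.
      by_cases he0 : ℓ e = 0
      · have htop := aotIdeal_eq_top (K := K) he0
        exact ⟨fun d _ => .of_eq_top htop _ _, fun d _ => .of_eq_top htop _ _⟩
      obtain ⟨k, c, hk⟩ := hch e he
      have hc : c ≠ 0 := by
        rintro rfl
        simp [hk] at he0
      -- Contraction therefore enlarges `C` by exactly one, matching the degree drop by one in both
      -- claims.
      have hkC : k ∉ C := fun hmem => he0 (by rw [hk, hC.chord_eq_zero hmem, smul_zero])
      let σ : Option {s // s ≠ e} ≃ ι := Equiv.optionSubtypeNe e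
      let ℓ' : Option {s // s ≠ e} → M := fun o => ℓ (σ o)
      let j' : Fin 5 → {s // s ≠ e} := fun i => ⟨j i, fun h => he ⟨i, h⟩⟩
      have hj' : Function.Injective j' := fun i₁ i₂ h => hj (congrArg Subtype.val h)
      have hcard' : Fintype.card {s // s ≠ e} = n := by
        rw [Fintype.card_subtype_compl, Fintype.card_subtype_eq, hcard, Nat.add_sub_cancel]
      have hren : rename j (linForm a) = rename σ (rename some (rename j' (linForm a))) := by
        simp only [rename_rename]
        rfl
      have hrange : ∀ s, s ∉ Set.range j' → (s : ι) ∉ Set.range j := by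
        rintro s hs ⟨i, hi⟩
        exact hs ⟨i, Subtype.ext hi⟩
      have hdel := ih (fun s => ℓ' (some s)) j' C hcard' hj' hC fun s hs => hch s (hrange s hs)
      have hcon := ih (contractNone (K := K) ℓ') j' (insert k C) hcard' hj' (hC.contract hc hk)
        fun s hs => by
          obtain ⟨i, c, hi⟩ := hch s (hrange s hs)
          refine ⟨i, c, ?_⟩
          change Submodule.Quotient.mk (ℓ s) = _
          rw [hi]
          rfl
      rw [Finset.card_insert_of_notMem hkC] at hcon
      have hhom : (rename j' (linForm a)).IsHomogeneous 1 :=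
        (linForm_isHomogeneous a).rename_isHomogeneous
      rw [hren]
      refine ⟨fun d hd => FlatInjective.of_equiv (ℓ := ℓ) σ ?_,
        fun d hd => CokernelVanishes.of_equiv (ℓ := ℓ) σ ?_⟩
      · exact FlatInjective.option (ℓ := ℓ') he0 (hdel.1 d hd)
          fun m hm => hcon.1 m (by omega)
      · exact CokernelVanishes.option (ℓ := ℓ') hhom (hdel.2 d hd)
          fun m hm => hcon.2 m (by omega)

end ChordInduction

/-! ### From degreewise statements to the WLP, and changes of sign. -/

section WeakLefschetz

variable {K : Type*} [Field K] {ι M : Type*} [AddCommGroup M] [Module K M]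

theorem homogeneousComponent_succ_mul {L : MvPolynomial ι K} (hL : L.IsHomogeneous 1)
    (f : MvPolynomial ι K) (n : ℕ) :
    homogeneousComponent (n + 1) (L * f) = L * homogeneousComponent n f := by
  let _ : GradedAlgebra (homogeneousSubmodule ι K) := gradedAlgebra
  have := DirectSum.coe_decompose_mul_add_of_left_mem (homogeneousSubmodule ι K) (i := 1) (j := n)
    (a := L) (b := f) hL
  rw [add_comm] at this
  rw [← decomposition.decompose'_apply, ← decomposition.decompose'_apply]
  exact this

theorem CokernelVanishes.succ [DecidableEq ι] {ℓ : ι → M} {L : MvPolynomial ι K} {n : ℕ}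
    (h : CokernelVanishes ℓ L n) : CokernelVanishes ℓ L (n + 1) := by
  intro g hg
  rw [g.as_sum]
  refine Ideal.sum_mem _ fun d hd => ?_
  have hdeg : d.degree = n + 1 := by
    by_contra hne
    exact (mem_support_iff.mp hd) (hg.coeff_eq_zero hne)
  obtain ⟨s, hs⟩ : ∃ s, d s ≠ 0 := by
    by_contra! hall
    have : d = 0 := by ext s; exact hall s
    simp [this] at hdeg
  have hd' : d = (d - Finsupp.single s 1) + Finsupp.single s 1 :=
    (tsub_add_cancel_of_le (by simpa using Nat.one_le_iff_ne_zero.mpr hs)).symm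
  have hdeg' : (d - Finsupp.single s 1).degree = n := by
    rw [hd', map_add, Finsupp.degree_single] at hdeg
    omega
  have : monomial d (coeff d g) = X s * monomial (d - Finsupp.single s 1) (coeff d g) := by
    rw [X, monomial_mul, one_mul, add_comm, ← hd']
  rw [this]
  exact Ideal.mul_mem_left _ _ (h _ (isHomogeneous_monomial _ hdeg'))

/-- One vanishing degree of the cokernel is enough, since the algebra is generated in degree 1 and
vanishing persists (`CokernelVanishes.succ`). -/
theorem hasWLP_aotIdeal [DecidableEq ι] {ℓ : ι → M} {L : MvPolynomial ι K} (hL : L.IsHomogeneous 1)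
    {n : ℕ} (hinj : ∀ d < n, ∀ f : MvPolynomial ι K, f.IsHomogeneous d →
      L * f ∈ aotIdeal K ℓ → f ∈ aotIdeal K ℓ)
    (hsurj : CokernelVanishes ℓ L (n + 1)) : HasWLP (aotIdeal K ℓ) := by
  refine ⟨L, hL, fun d => ?_⟩
  by_cases hd : d < n
  · left
    rw [← LinearMap.ker_eq_bot, LinearMap.ker_eq_bot']
    rintro ⟨_, f, hf, rfl⟩ h
    have h' := congrArg Subtype.val h
    have h2 : Ideal.Quotient.mk (aotIdeal K ℓ) (L * f) = 0 := by
      rw [map_mul]; exact h'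
    have := hinj d hd f hf (Ideal.Quotient.eq_zero_iff_mem.mp h2)
    exact Subtype.ext (Ideal.Quotient.eq_zero_iff_mem.mpr this)
  · right
    rintro ⟨_, g, hg, rfl⟩
    have hcok : CokernelVanishes ℓ L (d + 1) := by
      obtain ⟨k, rfl⟩ := Nat.exists_eq_add_of_le (not_lt.mp hd)
      clear hd hg
      induction k with
      | zero => exact hsurj
      | succ k ih => exact ih.succ
    obtain ⟨q, hq, hqhom, hqL⟩ := exists_isHomogeneous_of_mem_sup_span hL hg (hcok g hg)
    obtain ⟨r, hr⟩ := Ideal.mem_span_singleton.mp hqL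
    have hg' : (g - q).IsHomogeneous (d + 1) := IsHomogeneous.sub hg hqhom
    have hr' : g - q = L * homogeneousComponent d r := by
      rw [← homogeneousComponent_succ_mul hL, ← hr, homogeneousComponent_eq_self hg']
    refine ⟨⟨_, homogeneousComponent d r, homogeneousComponent_isHomogeneous d r, rfl⟩,
      Subtype.ext ?_⟩
    change Ideal.Quotient.mk _ L * Ideal.Quotient.mk _ (homogeneousComponent d r) =
      Ideal.Quotient.mk _ g
    rw [← map_mul, ← hr', map_sub, Ideal.Quotient.eq_zero_iff_mem.mpr hq, sub_zero]

/-- The substitution `y_i ↦ ε_i y_i`. -/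
def rescale (ε : ι → K) : MvPolynomial ι K →ₐ[K] MvPolynomial ι K := aeval fun i => C (ε i) * X i

theorem rescale_rescale {ε : ι → K} (hε : ∀ i, ε i * ε i = 1) (f : MvPolynomial ι K) :
    rescale ε (rescale ε f) = f := by
  have : (rescale ε).comp (rescale ε) = AlgHom.id K (MvPolynomial ι K) := by
    ext1 i
    simp only [rescale, AlgHom.comp_apply, aeval_X, map_mul, algHom_C, algebraMap_eq,
      AlgHom.id_apply]
    rw [← mul_assoc, ← C_mul, hε, C_1, one_mul]
  exact DFunLike.congr_fun this f

theorem rescale_isHomogeneous (ε : ι → K) {f : MvPolynomial ι K} {n : ℕ} (hf : f.IsHomogeneous n) :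
    (rescale ε f).IsHomogeneous n := by
  simpa [rescale] using hf.aeval (fun i => C (ε i) * X i) (n := 1)
    fun i => isHomogeneous_C_mul_X _ _

/-- The relation `c` of `ℓ` becomes the relation `c t * ε t` of `ℓ'`, and the rescaled generator is
the new generator times the product of all signs over `Λ`. -/
theorem rescale_mem_aotIdeal [DecidableEq ι] {ℓ ℓ' : ι → M} {ε : ι → K} (hε : ∀ i, ε i * ε i = 1)
    (hℓ : ∀ i, ℓ' i = ε i • ℓ i) {f : MvPolynomial ι K} (hf : f ∈ aotIdeal K ℓ) :
    rescale ε f ∈ aotIdeal K ℓ' := by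
  refine aotIdeal_induction (P := fun g => rescale ε g ∈ aotIdeal K ℓ') (fun Λ c h => ?_)
    (fun i => ?_) ?_ (fun f g hf hg => ?_) (fun p f hf => ?_) hf
  · have := relation_mem_aotIdeal (K := K) (ℓ := ℓ') (Λ := Λ) (c := fun i => c i * ε i) (by
      simpa [hℓ, smul_smul, mul_assoc, hε] using h)
    convert Ideal.mul_mem_left _ (C (∏ s ∈ Λ, ε s)) this using 1
    simp only [rescale, map_sum, map_mul, map_prod, aeval_X, algHom_C, Finset.mul_sum,
      algebraMap_eq]
    refine Finset.sum_congr rfl fun t ht => ?_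
    rw [Finset.prod_mul_distrib, ← Finset.mul_prod_erase Λ _ ht]
    have h1 : (C (ε t) * C (ε t) : MvPolynomial ι K) = 1 := by rw [← C_mul, hε, C_1]
    linear_combination -(C (c t) * (∏ s ∈ Λ.erase t, C (ε s)) * ∏ s ∈ Λ.erase t, X s) * h1
  · have h1 : rescale ε (X i ^ 2) = X i ^ 2 := by
      have h1 : (C (ε i) * C (ε i) : MvPolynomial ι K) = 1 := by rw [← C_mul, hε, C_1]
      simp only [rescale, map_pow, aeval_X]
      linear_combination X i ^ 2 * h1
    rw [h1]
    exact X_sq_mem_aotIdeal ℓ' i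
  · simp
  · rw [map_add]; exact Ideal.add_mem _ hf hg
  · rw [map_mul]; exact Ideal.mul_mem_left _ _ hf

/-- A family consisting, up to signs, of a five-cycle and chords has the weak Lefschetz property. -/
theorem hasWLP_aotIdeal_of_chords [CharZero K] [Fintype ι] [DecidableEq ι] [FiniteDimensional K M]
    {ℓ ℓ' : ι → M} {ε : ι → K} (hε : ∀ i, ε i * ε i = 1) (hℓ : ∀ i, ℓ' i = ε i • ℓ i)
    {j : Fin 5 → ι} (hj : Function.Injective j) (hC : HasRelations (K := K) (fun i => ℓ' (j i)) ∅)
    (hch : ∀ s, s ∉ Set.range j → ∃ i, ∃ c : K, ℓ' s = c • (ℓ' (j i) + ℓ' (j (i + 1)))) :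
    HasWLP (aotIdeal K ℓ) := by
  have hℓ' : ∀ i, ℓ i = ε i • ℓ' i := fun i => by rw [hℓ, smul_smul, hε, one_smul]
  -- Any nonzero entries work whose cyclic neighbours differ, including the last and the first.
  let a : Fin 5 → K := ![1, 2, 3, 4, 5]
  have ha : ∀ i, a i ≠ 0 := by
    intro i; fin_cases i <;> simp [a]
  have ha' : ∀ i, a i ≠ a (i + 1) := by
    intro i; fin_cases i <;> simp [a]
  obtain ⟨h1, h2⟩ := maximal_rank_of_chords ha ha' _ ℓ' j ∅ rfl hj hC hch
  set L := rename j (linForm a)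
  have hL : L.IsHomogeneous 1 := (linForm_isHomogeneous a).rename_isHomogeneous
  refine hasWLP_aotIdeal (L := rescale ε L) (n := 3) (rescale_isHomogeneous ε hL) ?_ ?_
  · intro d hd f hf hmem
    have := rescale_mem_aotIdeal hε hℓ hmem
    rw [map_mul, rescale_rescale hε] at this
    have h3 := h1 d (by simp; omega) _ (rescale_isHomogeneous ε hf)
      (killedByFlats_of_mem_aotIdeal this)
    rw [← rescale_rescale hε f]
    exact rescale_mem_aotIdeal hε hℓ' h3
  · intro g hg
    obtain ⟨p, hp, q, hq, hpq⟩ := Submodule.mem_sup.mp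
      (h2 4 (by simp) _ (rescale_isHomogeneous ε hg))
    rw [← rescale_rescale hε g, ← hpq, map_add]
    refine Ideal.add_mem _ (Ideal.mem_sup_left (rescale_mem_aotIdeal hε hℓ' hp))
      (Ideal.mem_sup_right ?_)
    rw [Ideal.mem_span_singleton] at hq ⊢
    exact map_dvd _ hq

end WeakLefschetz

/-! ### Graphic arrangements on five vertices. -/

section Graph

variable {K : Type*} [Field K] {V : Type*}

/-- The linear form `x_i - x_j`. -/
def diffForm (K : Type*) [Field K] {V : Type*} (i j : V) : Module.Dual K (V → K) :=
  (LinearMap.proj i : (V → K) →ₗ[K] K) - LinearMap.proj j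

theorem diffForm_add (i j k : V) : diffForm K i j + diffForm K j k = diffForm K i k := by
  simp [diffForm]

theorem neg_diffForm (i j : V) : -diffForm K i j = diffForm K j i := by
  simp [diffForm]

theorem graphicForm_eq_or [LinearOrder V] (G : SimpleGraph V) (e : G.edgeSet) {i j : V}
    (h : (e : Sym2 V) = s(i, j)) :
    graphicForm K G e = diffForm K i j ∨ graphicForm K G e = -diffForm K i j := by
  rw [neg_diffForm, graphicForm, h]
  rcases le_total i j with hij | hij
  · left; simp [diffForm, hij]
  · right; simp [diffForm, hij]

/-- Evaluating a relation at the basis vector of `v (i + 1)` gives `b (i + 1) = b i`; conversely the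
sum telescopes around the cycle. -/
theorem hasRelations_diffForm {v : Fin 5 → V} (hv : Function.Injective v) :
    HasRelations (K := K) (fun i => diffForm K (v i) (v (i + 1))) ∅ := by
  classical
  intro b
  simp only [Finset.coe_empty, Set.image_empty, insert_empty_eq, Submodule.mem_span_singleton]
  constructor
  · intro h
    have h1 : ∀ i, b (i + 1) = b i := by
      intro i
      have := LinearMap.congr_fun h (Pi.single (v (i + 1)) 1)
      simp [diffForm, Pi.single_apply, hv.eq_iff, mul_sub, Finset.sum_sub_distrib] at this
      exact sub_eq_zero.mp this
    refine ⟨b 0, ?_⟩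
    have h10 := h1 0
    have h21 := h1 1
    have h32 := h1 2
    have h43 := h1 3
    ext i
    fin_cases i <;> simp_all
  · rintro ⟨t, rfl⟩
    simp only [Pi.smul_apply, Pi.one_apply, ← Finset.smul_sum, smul_assoc]
    have : ∑ i, diffForm K (v i) (v (i + 1)) = 0 := by
      simp only [diffForm, Finset.sum_sub_distrib]
      exact sub_eq_zero.mpr
        (Equiv.sum_comp (Equiv.addRight 1) fun i => (LinearMap.proj (v i) : (V → K) →ₗ[K] K)).symm
    simp [this]

/-- The Artinian Orlik-Terao algebra of every Hamiltonian graph on five vertices has the weak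
Lefschetz property. -/
theorem hasWLP_graphicAOTIdeal [CharZero K] [LinearOrder V] [Fintype V] (hV : Fintype.card V = 5)
    (G : SimpleGraph V) {v : Fin 5 → V} (hv : Function.Injective v)
    (hadj : ∀ i, G.Adj (v i) (v (i + 1))) : HasWLP (graphicAOTIdeal K G) := by
  classical
  have hsurj : Function.Surjective v :=
    ((Fintype.bijective_iff_injective_and_card v).mpr ⟨hv, by simp [hV]⟩).2
  let j : Fin 5 → G.edgeSet := fun i => ⟨s(v i, v (i + 1)), hadj i⟩
  have hj : Function.Injective j := by
    intro i k h
    have h' := congrArg Subtype.val h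
    simp only [j, Sym2.eq_iff, hv.eq_iff] at h'
    clear h
    revert i k
    decide
  -- The signs turn the forms of the cycle edges, oriented by the vertex order, into forms oriented
  -- along the cycle; chords keep sign 1.
  let ε : G.edgeSet → K := fun e =>
    if ∃ i, j i = e ∧ graphicForm K G e ≠ diffForm K (v i) (v (i + 1)) then -1 else 1
  have hcycle : ∀ i, ε (j i) • graphicForm K G (j i) = diffForm K (v i) (v (i + 1)) := by
    intro i
    by_cases h : graphicForm K G (j i) = diffForm K (v i) (v (i + 1))
    · have : ¬ ∃ k, j k = j i ∧ graphicForm K G (j i) ≠ diffForm K (v k) (v (k + 1)) := by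
        rintro ⟨k, hk, hne⟩
        rw [hj hk] at hne
        exact hne h
      simp only [ε, if_neg this, one_smul, h]
    · have hneg := (graphicForm_eq_or (K := K) G (j i) rfl).resolve_left h
      have : ∃ k, j k = j i ∧ graphicForm K G (j i) ≠ diffForm K (v k) (v (k + 1)) := ⟨i, rfl, h⟩
      simp only [ε, if_pos this, hneg, smul_neg, neg_smul, one_smul, neg_neg]
  refine hasWLP_aotIdeal_of_chords (ℓ := graphicForm K G) (ε := ε)
    (ℓ' := fun e => ε e • graphicForm K G e) ?_ (fun _ => rfl) hj ?_ ?_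
  · intro e
    simp only [ε]
    split_ifs <;> simp
  · simp only [hcycle]
    exact hasRelations_diffForm hv
  · intro e he
    simp only [hcycle]
    obtain ⟨i, k, hik⟩ : ∃ i k, (e : Sym2 V) = s(v i, v k) := by
      obtain ⟨⟨x, y⟩, h⟩ := Quot.exists_rep (e : Sym2 V)
      obtain ⟨i, rfl⟩ := hsurj x
      obtain ⟨k, rfl⟩ := hsurj y
      exact ⟨i, k, h.symm⟩
    have hne : i ≠ k := by
      rintro rfl
      have := e.2
      rw [hik] at this
      exact G.loopless.irrefl _ this
    have h1 : k ≠ i + 1 := by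
      rintro rfl
      exact he ⟨i, Subtype.ext hik.symm⟩
    have h2 : i ≠ k + 1 := by
      rintro rfl
      exact he ⟨k, Subtype.ext (hik.trans Sym2.eq_swap).symm⟩
    -- In ℤ/5 two distinct non-neighbours differ by ±2, so every chord closes a triangle with two
    -- consecutive cycle edges.
    have h3 : k = i + 1 + 1 ∨ i = k + 1 + 1 := by
      clear hik; revert i k; decide
    have h4 : ∃ i c, graphicForm K G e = (c : K) •
        (diffForm K (v i) (v (i + 1)) + diffForm K (v (i + 1)) (v (i + 1 + 1))) := by
      simp only [diffForm_add]
      rcases h3 with rfl | rfl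
      · rcases graphicForm_eq_or (K := K) G e hik with h | h
        · exact ⟨i, 1, by rw [h, one_smul]⟩
        · exact ⟨i, -1, by rw [h]; exact (neg_one_smul K _).symm⟩
      · rcases graphicForm_eq_or (K := K) G e (hik.trans Sym2.eq_swap) with h | h
        · exact ⟨k, 1, by rw [h, one_smul]⟩
        · exact ⟨k, -1, by rw [h]; exact (neg_one_smul K _).symm⟩
    obtain ⟨i, c, h⟩ := h4
    exact ⟨i, ε e * c, by rw [h, smul_smul]⟩

end Graph
end

/-- The assumption `hWLP` on initial ideals is not needed for the conclusion, which holds for every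
Hamiltonian graph on five vertices. -/
theorem theorem3p8 {K : Type*} [Field K] [CharZero K]
    {V : Type*} [LinearOrder V] [Fintype V] (hV : Fintype.card V = 5)
    (G : SimpleGraph V)
    {v : V} (p : G.Walk v v) (hp : p.IsCycle) (hp5 : p.length = 5)
    (m : MonomialOrder G.edgeSet)
    (hWLP : HasWLP (initialIdeal m (graphicAOTIdeal K G)))
    (u w : V) (hu : u ∈ p.support) (hw : w ∈ p.support) (huw : u ≠ w) (hadj : ¬ G.Adj u w) :
    HasWLP (graphicAOTIdeal K (G ⊔ SimpleGraph.edge u w)) := by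
  refine hasWLP_graphicAOTIdeal hV _ (v := fun i : Fin 5 => p.getVert i) ?_ ?_
  · intro i k h
    have := hp.getVert_injOn' (by simp; omega) (by simp; omega) h
    exact Fin.ext this
  · intro i
    refine Or.inl ?_
    have hstep := p.adj_getVert_succ (i := i) (by omega)
    -- Addition in `Fin 5` wraps at `i = 4`, where the closed walk returns: positions 5 and 0 are
    -- both `v`.
    have : p.getVert ((i + 1 : Fin 5) : ℕ) = p.getVert (i + 1) := by
      by_cases hi : i = 4
      · subst hi
        have h5 : p.getVert 5 = v := by rw [← hp5]; exact p.getVert_length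
        simpa using h5.symm
      · congr 1
        clear hstep
        revert i; decide
    rwa [this]
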